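/- For each $n\in\mathbb N$ let $D_n$ (the data) and $W_n^*$ (auxiliary variates) be random elements of standard Borel (Polish) spaces defined on a common probability space (which may depend on $n$). Let $\tau_n=\tau_n(D_n)$ and $\tau_n^*=\tau_n^*(D_n,W_n^*)$ be real random variables, measurable functions of the indicated arguments, and let $X_n$ be a $D_n$-measurable random element of a standard Borel space. Let $p_n^*:=P(\tau_n^*\le\tau_n\mid D_n)$ be the bootstrap p-value. The bootstrap is called valid conditionally on $X_n$ if $P(p_n^*\le q\mid X_n)\to q$ in probability for every $q\in(0,1)$. Write $\mathscr D(\mathbb R)$ for the space of càdlàg functions $\mathbb R\to\mathbb R$ with the Skorokhod $J_1$-topology, and $F^{-1}(u):=\sup\{v\in\mathbb R:F(v)\le u\}$ for the right-continuous generalized inverse of a cdf $F$; conditional distributions are taken regular. Suppose that there are random cdfs $F,F^*$ (random elements of $\mathscr D(\mathbb R)$) with a.s. continuous sample paths and a random element $X'$ of a Polish space, all defined on one probability space, with $F^*$ a.s. equal to a measurable function of $X'$, and $X_n$-measurable random elements $X_n'$ of the same Polish space, such that $$\bigl(P(\tau_n\le\cdot\mid X_n),\;P(\tau_n^*\le\cdot\mid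 D_n),\;X_n'\bigr)\xrightarrow{w}(F,F^*,X')$$ in $\mathscr D(\mathbb R)\times\mathscr D(\mathbb R)$ times the space of $X'$. Then: 1. For Lebesgue-almost all $q\in(0,1)$, $P(p_n^*\le q\mid X_n)\xrightarrow{w}F(F^{*-1}(q))$. 2. The bootstrap based on $\tau_n$ and $\tau_n^*$ is valid conditionally on $X_n$ if and only if $F=F^*$ almost surely (i.e. up to indistinguishability). 3. If $F=F^*$ almost surely, then $\sup_{u\in\mathbb R}\bigl|P(\tau_n\le u\mid X_n)-P(\tau_n^*\le u\mid D_n)\bigr|\to0$ in probability. -/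

import Mathlib

open MeasureTheory ProbabilityTheory Filter Topology Set

noncomputable section

/-- Càdlàg functions `ℝ → ℝ`: right-continuous with (finite) left limits at every point. -/
structure CadlagFun where
  /-- the underlying function -/
  toFun : ℝ → ℝ
  right_cont : ∀ t, ContinuousWithinAt toFun (Ici t) t
  left_lim : ∀ t, ∃ l, Tendsto toFun (𝓝[<] t) (𝓝 l)

namespace CadlagFun

instance : CoeFun CadlagFun fun _ => ℝ → ℝ := ⟨CadlagFun.toFun⟩

/-- Skorokhod `J₁`-convergence of a sequence in `D(ℝ)`: there are increasing bijections `lam n`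
of `ℝ` such that `lam n → id` and `x n ∘ lam n → y`, both uniformly on compact sets. -/
def TendstoJ1 (x : ℕ → CadlagFun) (y : CadlagFun) : Prop :=
  ∃ lam : ℕ → ℝ ≃o ℝ, ∀ T : ℝ,
    TendstoUniformlyOn (fun n t => lam n t) (fun t => t) atTop (Icc (-T) T) ∧
    TendstoUniformlyOn (fun n t => x n (lam n t)) (fun t => y t) atTop (Icc (-T) T)

/-- The Skorokhod `J₁`-topology on `D(ℝ)`. It is metrizable, hence determined by its convergent
sequences: a set is open iff every sequence that `J₁`-converges to one of its points is
eventually inside the set. -/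
instance : TopologicalSpace CadlagFun where
  IsOpen U := ∀ y ∈ U, ∀ x : ℕ → CadlagFun, TendstoJ1 x y → ∀ᶠ n in atTop, x n ∈ U
  isOpen_univ := fun _ _ _ _ => Eventually.of_forall fun _ => mem_univ _
  isOpen_inter := fun _ _ hU hV y hy x hx => (hU y hy.1 x hx).and (hV y hy.2 x hx)
  isOpen_sUnion := fun _ hS y hy x hx => by
    obtain ⟨U, hU, hyU⟩ := hy
    exact (hS U hU y hyU x hx).mono fun n hn => ⟨U, hU, hn⟩

instance : MeasurableSpace CadlagFun := borel CadlagFun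

instance : BorelSpace CadlagFun := ⟨rfl⟩

/-- A monotone right-continuous function, as an element of `D(ℝ)`. -/
def ofStieltjes (f : StieltjesFunction ℝ) : CadlagFun where
  toFun := f
  right_cont := f.right_continuous
  left_lim := fun t => ⟨_, f.mono.tendsto_leftLim t⟩

/-- `f` is a cumulative distribution function (right-continuity is part of `CadlagFun`). -/
def IsCDF (f : CadlagFun) : Prop :=
  Monotone f ∧ Tendsto f atBot (𝓝 0) ∧ Tendsto f atTop (𝓝 1)

end CadlagFun

/-- Right-continuous generalized inverse `F⁻¹(u) = sup {v : F(v) ≤ u}`. -/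
def genInv (f : ℝ → ℝ) (u : ℝ) : ℝ := sSup {v : ℝ | f v ≤ u}

/-- Weak convergence `Z n →w Z'` of random elements of a topological space with its Borel
`σ`-algebra; `Z n` and `Z'` may live on different probability spaces. -/
def TendstoWeakly {S : Type*} [TopologicalSpace S] {Ω : ℕ → Type*} [∀ n, MeasurableSpace (Ω n)]
    {Ω' : Type*} [MeasurableSpace Ω'] (Z : (n : ℕ) → Ω n → S) (Z' : Ω' → S)
    (P : (n : ℕ) → Measure (Ω n)) [∀ n, IsProbabilityMeasure (P n)]
    (P' : Measure Ω') [IsProbabilityMeasure P'] : Prop :=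
  letI : MeasurableSpace S := borel S
  haveI : BorelSpace S := ⟨rfl⟩
  TendstoInDistribution Z atTop Z' P P'

/-- Convergence in probability to a constant, `Z n` possibly on different probability spaces. -/
def TendstoInProbConst {Ω : ℕ → Type*} [∀ n, MeasurableSpace (Ω n)]
    (P : (n : ℕ) → Measure (Ω n)) (Z : (n : ℕ) → Ω n → ℝ) (c : ℝ) : Prop :=
  ∀ ε > 0, Tendsto (fun n => P n {ω | ε ≤ |Z n ω - c|}) atTop (𝓝 0)

/-- The random cdf `P(Y ≤ · | X)` as a random element of `D(ℝ)`, computed from the regular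
conditional distribution of `Y` given `X`. -/
def condCdf {Ω S : Type*} [MeasurableSpace Ω] [MeasurableSpace S] (P : Measure Ω)
    [IsProbabilityMeasure P] (Y : Ω → ℝ) (X : Ω → S) (ω : Ω) : CadlagFun :=
  CadlagFun.ofStieltjes (cdf (condDistrib Y X P (X ω)))

/-- Conditional probability `P(A | X)` of the event `A` given the random element `X`. -/
def condProbGiven {Ω S : Type*} [MeasurableSpace Ω] [MeasurableSpace S] (P : Measure Ω)
    (A : Set Ω) (X : Ω → S) : Ω → ℝ :=
  P[A.indicator (fun _ => (1 : ℝ)) | MeasurableSpace.comap X inferInstance]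

/-- The bootstrap p-value `p* = P(τ* ≤ τ | D)`. -/
def bootPValue {Ω S : Type*} [MeasurableSpace Ω] [MeasurableSpace S] (P : Measure Ω)
    (D : Ω → S) (τ τstar : Ω → ℝ) : Ω → ℝ :=
  condProbGiven P {ω | τstar ω ≤ τ ω} D

/-- `P(p* ≤ q | X)`. -/
def condPValueCdf {Ω S R : Type*} [MeasurableSpace Ω] [MeasurableSpace S] [MeasurableSpace R]
    (P : Measure Ω) (D : Ω → S) (τ τstar : Ω → ℝ) (X : Ω → R) (q : ℝ) : Ω → ℝ :=
  condProbGiven P {ω | bootPValue P D τ τstar ω ≤ q} X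

/-- The bootstrap based on `τ n`, `τstar n` is valid conditionally on `X n`:
`P(p*_n ≤ q | X_n) → q` in probability for every `q ∈ (0,1)`. -/
def BootstrapValidCond {Ω S R : ℕ → Type*} [∀ n, MeasurableSpace (Ω n)]
    [∀ n, MeasurableSpace (S n)] [∀ n, MeasurableSpace (R n)]
    (P : (n : ℕ) → Measure (Ω n)) (D : (n : ℕ) → Ω n → S n)
    (τ τstar : (n : ℕ) → Ω n → ℝ) (X : (n : ℕ) → Ω n → R n) : Prop :=
  ∀ q ∈ Ioo (0 : ℝ) 1,
    TendstoInProbConst P (fun n => condPValueCdf (P n) (D n) (τ n) (τstar n) (X n) q) q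

end

/-! Write `F_n = P(τ_n ≤ · | X_n)` and `F_n* = P(τ_n* ≤ · | D_n)`. Since `τ_n` is a function of
`D_n`, the p-value is `F_n*(τ_n)`, so `{p_n* ≤ q}` is essentially `{τ_n ≤ F_n*⁻¹(q)}`. This random
quantile need not be `X_n`-measurable and so cannot be inserted into `F_n`. In the limit, however,
`F*⁻¹(q)` is a function of `X'`, hence within `ε` of some continuous `g(X')` with high probability,
and `g(X_n')` is `X_n`-measurable. By the portmanteau theorem `F_n*` then crosses `q` near `g(X_n')`
for large `n`, so outside a small event `{τ_n ≤ g - 2ε} ⊆ {p_n* ≤ q} ⊆ {τ_n ≤ g + 2ε}`. Conditioning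
on `X_n` squeezes `P(p_n* ≤ q | X_n)` between values of `F_n` near `g(X_n')`, and continuity of `F`
closes the gap (`integral_abs_condPValueCdf_sub_avg_le`, `exists_continuous_approx_quantile`). The
crossing needs `F*` not to be flat at level `q`, which excludes countably many `q`.

Point evaluation is not `J₁`-continuous, so it is replaced throughout by averages `avg f a b`, which
are continuous in `f` and lie between `f a` and `f b` for a cdf.

Validity forces `F(F*⁻¹(q)) = q` a.s. on a countable dense set of levels, hence `F = F*`. Conversely
`F = F*` makes the weak limit the constant `q`, and monotonicity in `q` recovers the excluded
levels. Uniform closeness follows from a continuous functional `gridGap` that dominates the uniform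
distance and is small on the diagonal. -/

noncomputable section

/-! ### Continuous functionals on the Skorokhod space. -/

namespace CadlagFun

lemma ext_toFun {f g : CadlagFun} (h : ∀ t, f t = g t) : f = g := by
  cases f; cases g; congr; exact funext h

/-- A map out of `D(ℝ)` is continuous as soon as it preserves `J₁`-convergence of sequences. -/
lemma continuous_of_tendstoJ1 {β : Type*} [TopologicalSpace β] {g : CadlagFun → β}
    (h : ∀ x y, TendstoJ1 x y → Tendsto (fun n => g (x n)) atTop (𝓝 (g y))) : Continuous g :=
  ⟨fun _ hU y hy x hx => (h x y hx).eventually (hU.mem_nhds hy)⟩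

/-- A càdlàg function has at most countably many discontinuities. -/
lemma countable_not_continuousAt (f : CadlagFun) : {u | ¬ ContinuousAt f u}.Countable := by
  -- A jump at `u` is encoded by rationals `(r, c)`: `c` separates the left limit from `f u`, and
  -- `f` stays on the left limit's side of `c` on `(r, u)`. Two points with the same code and the
  -- same direction of jump would contradict each other.
  have key : {u | ¬ ContinuousAt f u} ⊆ ⋃ p : ℚ × ℚ,
      ({u | (p.1 : ℝ) < u ∧ (p.2 : ℝ) < f u ∧ ∀ v ∈ Ioo (p.1 : ℝ) u, f v < p.2} ∪
       {u | (p.1 : ℝ) < u ∧ f u < p.2 ∧ ∀ v ∈ Ioo (p.1 : ℝ) u, (p.2 : ℝ) < f v}) := by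
    intro u hu
    obtain ⟨l, hl⟩ := f.left_lim u
    have hne : l ≠ f u := by
      rintro rfl
      exact hu (continuousAt_iff_continuous_left'_right'.2
        ⟨hl, (f.right_cont u).mono Ioi_subset_Ici_self⟩)
    have left : ∀ s ∈ 𝓝[<] u, ∃ r : ℚ, (r : ℝ) < u ∧ Ioo (r : ℝ) u ⊆ s := by
      intro s hs
      obtain ⟨a, ha, has⟩ := (mem_nhdsLT_iff_exists_Ioo_subset (a := u)).1 hs
      obtain ⟨r, hr1, hr2⟩ := exists_rat_btwn (show a < u from ha)
      exact ⟨r, hr2, (Ioo_subset_Ioo_left hr1.le).trans has⟩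
    rcases lt_or_gt_of_ne hne with h | h
    · obtain ⟨c, hc1, hc2⟩ := exists_rat_btwn h
      obtain ⟨r, hr, hs⟩ := left _ (hl.eventually (gt_mem_nhds hc1))
      exact mem_iUnion.2 ⟨(r, c), Or.inl ⟨hr, hc2, fun v hv => hs hv⟩⟩
    · obtain ⟨c, hc1, hc2⟩ := exists_rat_btwn h
      obtain ⟨r, hr, hs⟩ := left _ (hl.eventually (lt_mem_nhds hc2))
      exact mem_iUnion.2 ⟨(r, c), Or.inr ⟨hr, hc1, fun v hv => hs hv⟩⟩
  refine (countable_iUnion fun p => Countable.union ?_ ?_).mono key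
  · refine Set.Subsingleton.countable fun u hu v hv => ?_
    by_contra hne
    rcases lt_or_gt_of_ne hne with h | h
    · exact (hv.2.2 u ⟨hu.1, h⟩).not_gt hu.2.1
    · exact (hu.2.2 v ⟨hv.1, h⟩).not_gt hv.2.1
  · refine Set.Subsingleton.countable fun u hu v hv => ?_
    by_contra hne
    rcases lt_or_gt_of_ne hne with h | h
    · exact (hv.2.2 u ⟨hu.1, h⟩).not_gt hu.2.1
    · exact (hu.2.2 v ⟨hv.1, h⟩).not_gt hv.2.1

lemma ae_continuousAt (f : CadlagFun) : ∀ᵐ u : ℝ, ContinuousAt f u :=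
  f.countable_not_continuousAt.measure_zero volume

lemma aestronglyMeasurable (f : CadlagFun) : AEStronglyMeasurable f (volume : Measure ℝ) := by
  have hm : MeasurableSet {u | ContinuousAt f u} := by
    have := f.countable_not_continuousAt.measurableSet.compl
    simpa [compl_ofPred] using this
  have h := ContinuousOn.aestronglyMeasurable (μ := volume) (f := f) (s := {u | ContinuousAt f u})
    (fun u hu => ContinuousAt.continuousWithinAt hu) hm
  rwa [Measure.restrict_eq_self_of_ae_mem (s := {u | ContinuousAt f u}) f.ae_continuousAt] at h

/-- `J₁`-convergence implies convergence at the continuity points of the limit. -/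
lemma TendstoJ1.tendsto_apply {x : ℕ → CadlagFun} {y : CadlagFun} (h : TendstoJ1 x y) {u : ℝ}
    (hu : ContinuousAt y u) : Tendsto (fun n => x n u) atTop (𝓝 (y u)) := by
  obtain ⟨lam, hlam⟩ := h
  obtain ⟨h1, h2⟩ := hlam (|u| + 1)
  rw [Metric.tendstoUniformlyOn_iff] at h1 h2
  have hu1 := abs_le.1 (le_refl |u|)
  -- Write `x n u = (x n ∘ lam n) ((lam n)⁻¹ u)`. The inverse time changes converge at `u` because
  -- `lam n` is monotone and close to the identity at `u ± d`; `d ≤ 1` keeps these points in the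
  -- compact interval.
  have hs : Tendsto (fun n => (lam n).symm u) atTop (𝓝 u) := by
    rw [Metric.tendsto_atTop']
    intro e he
    set d := min (e / 2) 1 with hd
    have hd0 : 0 < d := by positivity
    have hd1 : d ≤ 1 := min_le_right _ _
    have hde : d < e := (min_le_left _ _).trans_lt (by linarith)
    obtain ⟨N, hN⟩ := eventually_atTop.1 (h1 d hd0)
    refine ⟨N, fun n hn => ?_⟩
    have a1 := hN n hn.le (u - d) ⟨by linarith, by linarith⟩
    have a2 := hN n hn.le (u + d) ⟨by linarith, by linarith⟩
    rw [Real.dist_eq, abs_lt] at a1 a2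
    have b1 : u - d ≤ (lam n).symm u := (OrderIso.le_symm_apply _).2 (by linarith)
    have b2 : (lam n).symm u ≤ u + d := (OrderIso.symm_apply_le _).2 (by linarith)
    rw [Real.dist_eq, abs_lt]
    constructor <;> linarith
  have hy := hu.tendsto.comp hs
  have hmem : ∀ᶠ n in atTop, (lam n).symm u ∈ Icc (-(|u| + 1)) (|u| + 1) :=
    hs.eventually (Icc_mem_nhds (by linarith) (by linarith))
  have h0 : Tendsto (fun n => x n u - y ((lam n).symm u)) atTop (𝓝 0) := by
    rw [Metric.tendsto_nhds]
    intro e he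
    filter_upwards [h2 e he, hmem] with n hn hm
    have := hn _ hm
    rw [dist_comm, OrderIso.apply_symm_apply] at this
    simpa [Real.dist_eq] using this
  simpa using h0.add hy

/-- `∫₀ᵃ f`, with the values of `f` clipped to `[0,1]`. -/
def cumInt (f : CadlagFun) (a : ℝ) : ℝ := ∫ u in (0 : ℝ)..a, max 0 (min 1 (f u))

lemma continuous_clip : Continuous fun z : ℝ => max 0 (min 1 z) := by fun_prop

lemma norm_clip_le (z : ℝ) : ‖max 0 (min 1 z)‖ ≤ 1 := by
  rw [Real.norm_eq_abs, abs_of_nonneg (le_max_left _ _)]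
  exact max_le zero_le_one (min_le_left _ _)

lemma intervalIntegrable_clip (f : CadlagFun) (a b : ℝ) :
    IntervalIntegrable (fun u => max 0 (min 1 (f u))) volume a b := by
  exact (intervalIntegrable_const (c := (1 : ℝ))).mono_fun'
    (continuous_clip.comp_aestronglyMeasurable f.aestronglyMeasurable).restrict
    (Eventually.of_forall fun u => norm_clip_le _)

lemma cumInt_sub (f : CadlagFun) (a b : ℝ) :
    cumInt f b - cumInt f a = ∫ u in a..b, max 0 (min 1 (f u)) :=
  intervalIntegral.integral_interval_sub_left (f.intervalIntegrable_clip 0 b)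
    (f.intervalIntegrable_clip 0 a)

/-- `J₁`-convergence gives pointwise convergence off a null set, and clipping supplies the
dominating constant, including for paths that are not cdfs. -/
lemma continuous_cumInt_left (a : ℝ) : Continuous fun f => cumInt f a := by
  refine continuous_of_tendstoJ1 fun x y h => ?_
  refine intervalIntegral.tendsto_integral_filter_of_dominated_convergence (fun _ => 1) ?_ ?_ ?_ ?_
  · exact Eventually.of_forall fun n =>
      (continuous_clip.comp_aestronglyMeasurable (x n).aestronglyMeasurable).restrict
  · exact Eventually.of_forall fun n => Eventually.of_forall fun u _ => norm_clip_le _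
  · exact intervalIntegrable_const
  · filter_upwards [y.ae_continuousAt] with u hu _
    exact (continuous_clip.tendsto _).comp (h.tendsto_apply hu)

lemma lipschitzWith_cumInt (f : CadlagFun) : LipschitzWith 1 (cumInt f) := by
  refine LipschitzWith.of_dist_le_mul fun a b => ?_
  rw [dist_comm, Real.dist_eq, cumInt_sub, ← Real.norm_eq_abs]
  refine (intervalIntegral.norm_integral_le_of_norm_le_const
    (fun u _ => norm_clip_le _)).trans (le_of_eq ?_)
  rw [dist_comm, Real.dist_eq]; simp

/-- The sequential criterion applies on `D(ℝ)` only, not on the product; the uniform Lipschitz bound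
in the endpoint upgrades separate to joint continuity. -/
lemma continuous_cumInt : Continuous fun p : CadlagFun × ℝ => cumInt p.1 p.2 :=
  continuous_prod_of_continuous_lipschitzWith' (fun p : CadlagFun × ℝ => cumInt p.1 p.2) 1
    lipschitzWith_cumInt continuous_cumInt_left

/-- The average over `[a,b]` of `f` clipped to `[0,1]`. -/
def avg (f : CadlagFun) (a b : ℝ) : ℝ := (cumInt f b - cumInt f a) / (b - a)

lemma continuous_avg_left (a b : ℝ) : Continuous fun f => avg f a b :=
  ((continuous_cumInt_left b).sub (continuous_cumInt_left a)).div_const _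

lemma continuous_avg_add {α : Type*} [TopologicalSpace α] {f : α → CadlagFun} (hf : Continuous f)
    {g : α → ℝ} (hg : Continuous g) (c d : ℝ) :
    Continuous fun z => avg (f z) (g z + c) (g z + d) := by
  have : (fun z => avg (f z) (g z + c) (g z + d)) =
      fun z => (cumInt (f z) (g z + d) - cumInt (f z) (g z + c)) / (d - c) := by
    funext z; rw [avg]; congr 1; ring
  rw [this]
  exact ((continuous_cumInt.comp (hf.prodMk (hg.add continuous_const))).sub
    (continuous_cumInt.comp (hf.prodMk (hg.add continuous_const)))).div_const _

lemma avg_nonneg (f : CadlagFun) {a b : ℝ} (h : a < b) : 0 ≤ avg f a b := by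
  rw [avg, cumInt_sub]
  exact div_nonneg (intervalIntegral.integral_nonneg h.le fun u _ => le_max_left _ _)
    (by linarith)

lemma avg_le_one (f : CadlagFun) {a b : ℝ} (h : a < b) : avg f a b ≤ 1 := by
  rw [avg, cumInt_sub, div_le_one (by linarith)]
  have := intervalIntegral.norm_integral_le_of_norm_le_const (a := a) (b := b) (C := 1)
    (f := fun u => max 0 (min 1 (f u))) (fun u _ => norm_clip_le _)
  rw [abs_of_pos (sub_pos.2 h), one_mul] at this
  exact (le_abs_self _).trans this

namespace IsCDF

variable {f : CadlagFun}

lemma nonneg (hf : f.IsCDF) (u : ℝ) : 0 ≤ f u := hf.1.le_of_tendsto hf.2.1 u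

lemma le_one (hf : f.IsCDF) (u : ℝ) : f u ≤ 1 := hf.1.ge_of_tendsto hf.2.2 u

lemma clip_eq (hf : f.IsCDF) (u : ℝ) : max 0 (min 1 (f u)) = f u := by
  rw [min_eq_right (hf.le_one u), max_eq_right (hf.nonneg u)]

lemma le_avg (hf : f.IsCDF) {a b : ℝ} (h : a < b) : f a ≤ avg f a b := by
  rw [avg, cumInt_sub, le_div_iff₀ (by linarith)]
  have := intervalIntegral.integral_mono_on h.le (intervalIntegrable_const (c := f a))
    (f.intervalIntegrable_clip a b) fun u hu => by rw [hf.clip_eq]; exact hf.1 hu.1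
  rw [intervalIntegral.integral_const, smul_eq_mul] at this
  linarith

lemma avg_le (hf : f.IsCDF) {a b : ℝ} (h : a < b) : avg f a b ≤ f b := by
  rw [avg, cumInt_sub, div_le_iff₀ (by linarith)]
  have := intervalIntegral.integral_mono_on h.le (f.intervalIntegrable_clip a b)
    (intervalIntegrable_const (c := f b)) fun u hu => by rw [hf.clip_eq]; exact hf.1 hu.2
  rw [intervalIntegral.integral_const, smul_eq_mul] at this
  linarith

end IsCDF

lemma isCDF_ofStieltjes_cdf (μ : Measure ℝ) : (ofStieltjes (cdf μ)).IsCDF :=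
  ⟨monotone_cdf μ, tendsto_cdf_atBot μ, tendsto_cdf_atTop μ⟩

/-! ### Generalized inverses of cdfs. -/

section genInv

variable {f : CadlagFun} {q : ℝ}

lemma IsCDF.bddAbove_le (hf : f.IsCDF) (hq : q < 1) : BddAbove {v : ℝ | f v ≤ q} := by
  obtain ⟨b, hb⟩ := (hf.2.2.eventually (lt_mem_nhds hq)).exists
  exact ⟨b, fun v hv => le_of_not_gt fun h => (hb.trans_le (hf.1 h.le)).not_ge hv⟩

lemma IsCDF.nonempty_le (hf : f.IsCDF) (hq : 0 < q) : {v : ℝ | f v ≤ q}.Nonempty := by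
  obtain ⟨b, hb⟩ := (hf.2.1.eventually (gt_mem_nhds hq)).exists
  exact ⟨b, hb.le⟩

lemma IsCDF.lt_of_genInv_lt (hf : f.IsCDF) (hq : q < 1) {v : ℝ} (h : genInv f q < v) : q < f v :=
  lt_of_not_ge fun h' => h.not_ge (le_csSup (hf.bddAbove_le hq) h')

lemma IsCDF.le_of_lt_genInv (hf : f.IsCDF) (hq : 0 < q) {v : ℝ} (h : v < genInv f q) :
    f v ≤ q := by
  obtain ⟨w, hw, hvw⟩ := exists_lt_of_lt_csSup (hf.nonempty_le hq) h
  exact (hf.1 hvw.le).trans hw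

lemma IsCDF.le_genInv (hf : f.IsCDF) (hq : q < 1) {v : ℝ} (h : f v ≤ q) : v ≤ genInv f q :=
  le_csSup (hf.bddAbove_le hq) h

lemma IsCDF.apply_genInv (hf : f.IsCDF) (hc : Continuous f) (hq : q ∈ Ioo (0 : ℝ) 1) :
    f (genInv f q) = q := by
  refine le_antisymm ?_ ?_
  · exact (isClosed_le hc continuous_const).csSup_mem (hf.nonempty_le hq.1) (hf.bddAbove_le hq.2)
  · refine ge_of_tendsto (hc.continuousAt.tendsto.mono_left
      (nhdsWithin_le_nhds (s := Ioi (genInv f q)))) ?_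
    exact eventually_nhdsWithin_of_forall fun v hv => (hf.lt_of_genInv_lt hq.2 hv).le

/-- A Borel functional on `D(ℝ)` which coincides with the generalized inverse on cdfs. -/
def quantile (q : ℝ) (f : CadlagFun) : ℝ :=
  (⨆ p : ℚ × ℚ, if p.1 < p.2 ∧ avg f p.1 p.2 ≤ q then ((p.1 : ℝ) : EReal) else ⊥).toReal

lemma measurable_quantile (q : ℝ) : Measurable (quantile q) := by
  refine Measurable.ereal_toReal (Measurable.iSup fun p => Measurable.ite ?_
    measurable_const measurable_const)
  refine MeasurableSet.inter (MeasurableSet.const _) ?_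
  exact measurableSet_le (continuous_avg_left _ _).measurable measurable_const

/-- An average at most `q` over `[r, s]` forces `f r ≤ q`, and any `r < s` below the inverse yields
such an average. Working in `EReal` makes the countable supremum measurable with no boundedness
condition off the set of cdfs. -/
lemma IsCDF.quantile_eq (hf : f.IsCDF) (hq : q ∈ Ioo (0 : ℝ) 1) :
    quantile q f = genInv f q := by
  rw [quantile, ← EReal.toReal_coe (genInv f q)]
  congr 1
  refine le_antisymm (iSup_le fun p => ?_) (le_of_forall_lt fun c hc => ?_)
  · split_ifs with h
    · have h1 : (p.1 : ℝ) < p.2 := by exact_mod_cast h.1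
      exact EReal.coe_le_coe_iff.2 (hf.le_genInv hq.2 ((hf.le_avg h1).trans h.2))
    · exact bot_le
  · obtain ⟨c', hc1, hc2⟩ := EReal.lt_iff_exists_real_btwn.1 hc
    rw [EReal.coe_lt_coe_iff] at hc2
    obtain ⟨r, hr1, hr2⟩ := exists_rat_btwn hc2
    obtain ⟨s, hs1, hs2⟩ := exists_rat_btwn hr2
    refine lt_of_lt_of_le (hc1.trans (EReal.coe_lt_coe_iff.2 hr1)) (le_iSup_of_le (r, s) ?_)
    rw [if_pos ⟨by exact_mod_cast hs1, (hf.avg_le hs1).trans (hf.le_of_lt_genInv hq.1 hs2)⟩]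

end genInv

end CadlagFun
end

noncomputable section

/-! ### Weak convergence and convergence in probability. -/

section Distribution

variable {Ω : ℕ → Type*} [∀ n, MeasurableSpace (Ω n)] {P : (n : ℕ) → Measure (Ω n)}
  [∀ n, IsProbabilityMeasure (P n)] {Ω' : Type*} [MeasurableSpace Ω'] {P' : Measure Ω'}
  [IsProbabilityMeasure P']

lemma TendstoWeakly.continuous_comp {S : Type*} [TopologicalSpace S] {Z : (n : ℕ) → Ω n → S}
    {Z' : Ω' → S} (h : TendstoWeakly Z Z' P P') {g : S → ℝ} (hg : Continuous g) :
    TendstoInDistribution (fun n ω => g (Z n ω)) atTop (fun ω => g (Z' ω)) P P' :=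
  letI : MeasurableSpace S := borel S
  haveI : BorelSpace S := ⟨rfl⟩
  TendstoInDistribution.continuous_comp hg h

lemma TendstoWeakly.tendsto_integral {S : Type*} [TopologicalSpace S] {Z : (n : ℕ) → Ω n → S}
    {Z' : Ω' → S} (h : TendstoWeakly Z Z' P P') {g : S → ℝ} (hg : Continuous g) {C : ℝ}
    (hC : ∀ z, ‖g z‖ ≤ C) :
    Tendsto (fun n => ∫ ω, g (Z n ω) ∂(P n)) atTop (𝓝 (∫ ω, g (Z' ω) ∂P')) := by
  let : MeasurableSpace S := borel S
  have : BorelSpace S := ⟨rfl⟩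
  have h' : TendstoInDistribution Z atTop Z' P P' := h
  have h1 := (ProbabilityMeasure.tendsto_iff_forall_integral_tendsto.1 h'.tendsto)
    (BoundedContinuousFunction.ofNormedAddCommGroup g hg C hC)
  have e : ∀ n, ∫ z, g z ∂((P n).map (Z n)) = ∫ ω, g (Z n ω) ∂(P n) := fun n =>
    integral_map (h'.forall_aemeasurable n) hg.measurable.aestronglyMeasurable
  have e' : ∫ z, g z ∂(P'.map Z') = ∫ ω, g (Z' ω) ∂P' :=
    integral_map h'.aemeasurable_limit hg.measurable.aestronglyMeasurable
  simpa only [ProbabilityMeasure.coe_mk, BoundedContinuousFunction.coe_ofNormedAddCommGroup,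
    e, e'] using h1

lemma MeasureTheory.TendstoInDistribution.eventually_measure_closed_lt {Z : (n : ℕ) → Ω n → ℝ}
    {Z' : Ω' → ℝ} (h : TendstoInDistribution Z atTop Z' P P') {C : Set ℝ} (hC : IsClosed C)
    {c : ENNReal} (hc : P' {ω | Z' ω ∈ C} < c) : ∀ᶠ n in atTop, P n {ω | Z n ω ∈ C} < c := by
  have h1 := ProbabilityMeasure.limsup_measure_closed_le_of_tendsto h.tendsto hC
  simp only [ProbabilityMeasure.coe_mk] at h1
  rw [Measure.map_apply_of_aemeasurable h.aemeasurable_limit hC.measurableSet] at h1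
  have h2 := eventually_lt_of_limsup_lt (h1.trans_lt hc)
  filter_upwards [h2] with n hn
  rwa [Measure.map_apply_of_aemeasurable (h.forall_aemeasurable n) hC.measurableSet] at hn

lemma MeasureTheory.TendstoInDistribution.measure_open_eq_zero {Z : (n : ℕ) → Ω n → ℝ}
    {Z' : Ω' → ℝ} (h : TendstoInDistribution Z atTop Z' P P') {G : Set ℝ} (hG : IsOpen G)
    (h0 : Tendsto (fun n => P n {ω | Z n ω ∈ G}) atTop (𝓝 0)) : P' {ω | Z' ω ∈ G} = 0 := by
  have h1 := ProbabilityMeasure.le_liminf_measure_open_of_tendsto h.tendsto hG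
  simp only [ProbabilityMeasure.coe_mk] at h1
  rw [Measure.map_apply_of_aemeasurable h.aemeasurable_limit hG.measurableSet] at h1
  have h2 : (fun n => (P n).map (Z n) G) = fun n => P n {ω | Z n ω ∈ G} := by
    funext n
    rw [Measure.map_apply_of_aemeasurable (h.forall_aemeasurable n) hG.measurableSet]; rfl
  rw [h2, h0.liminf_eq] at h1
  exact le_antisymm h1 bot_le

lemma TendstoInProbConst.ae_eq_of_tendstoInDistribution {Z : (n : ℕ) → Ω n → ℝ} {Z' : Ω' → ℝ}
    {c : ℝ} (h : TendstoInProbConst P Z c) (h' : TendstoInDistribution Z atTop Z' P P') :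
    ∀ᵐ ω ∂P', Z' ω = c := by
  have key : ∀ k : ℕ, ∀ᵐ ω ∂P', |Z' ω - c| ≤ 1 / ((k : ℝ) + 1) := by
    intro k
    have hk : (0 : ℝ) < 1 / ((k : ℝ) + 1) := by positivity
    have hG : IsOpen {z : ℝ | 1 / ((k : ℝ) + 1) < |z - c|} :=
      isOpen_lt continuous_const (by fun_prop)
    have h0 := h'.measure_open_eq_zero hG (tendsto_of_tendsto_of_tendsto_of_le_of_le
      tendsto_const_nhds (h _ hk) (fun _ => bot_le)
      fun n => measure_mono fun ω (hω : 1 / ((k : ℝ) + 1) < |Z n ω - c|) => hω.le)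
    rw [ae_iff]
    simpa using h0
  filter_upwards [ae_all_iff.2 key] with ω hω
  have : |Z' ω - c| ≤ 0 := ge_of_tendsto' tendsto_one_div_add_atTop_nhds_zero_nat hω
  exact sub_eq_zero.1 (abs_eq_zero.1 (le_antisymm this (abs_nonneg _)))

lemma MeasureTheory.TendstoInDistribution.tendstoInProbConst {Z : (n : ℕ) → Ω n → ℝ} {Z' : Ω' → ℝ}
    {c : ℝ} (h : TendstoInDistribution Z atTop Z' P P') (hc : ∀ᵐ ω ∂P', Z' ω = c) :
    TendstoInProbConst P Z c := by
  intro e he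
  rw [ENNReal.tendsto_nhds_zero]
  intro d hd
  have hC : IsClosed {z : ℝ | e ≤ |z - c|} := isClosed_le continuous_const (by fun_prop)
  have h0 : P' {ω | Z' ω ∈ {z : ℝ | e ≤ |z - c|}} = 0 := by
    refine measure_eq_zero_iff_ae_notMem.2 ?_
    filter_upwards [hc] with ω hω h1
    have h2 : e ≤ |Z' ω - c| := h1
    rw [hω, sub_self, abs_zero] at h2
    exact h2.not_gt he
  exact (h.eventually_measure_closed_lt hC (h0.trans_lt hd)).mono fun n hn => hn.le

lemma abs_integral_comp_sub_le {α : Type*} [MeasurableSpace α] {μ : Measure α}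
    [IsProbabilityMeasure μ] {f : ℝ → ℝ} {C : ℝ} (hC : ∀ x y, dist (f x) (f y) ≤ C)
    {L : NNReal} (hL : LipschitzWith L f) {A B : α → ℝ} (hA : AEMeasurable A μ)
    (hB : AEMeasurable B μ) (hAB : Integrable (fun x => A x - B x) μ) :
    |∫ x, f (A x) ∂μ - ∫ x, f (B x) ∂μ| ≤ L * ∫ x, |A x - B x| ∂μ := by
  have hbd : ∀ z, ‖f z‖ ≤ C + |f 0| := fun z => by
    have := hC z 0
    rw [Real.dist_eq] at this
    rw [Real.norm_eq_abs]
    linarith [abs_sub_abs_le_abs_sub (f z) (f 0)]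
  have hi : ∀ {A : α → ℝ}, AEMeasurable A μ → Integrable (fun x => f (A x)) μ := fun {A} hA =>
    (integrable_const (C + |f 0|)).mono'
      (hL.continuous.comp_aestronglyMeasurable hA.aestronglyMeasurable)
      (Eventually.of_forall fun x => hbd _)
  rw [← integral_sub (hi hA) (hi hB), ← integral_const_mul]
  refine (abs_integral_le_integral_abs).trans
    (integral_mono ((hi hA).sub (hi hB)).abs (hAB.abs.const_mul _) fun x => ?_)
  have := hL.dist_le_mul (A x) (B x)
  simpa [Real.dist_eq] using this

/-- Convergence in distribution of random variables that can be approximated in `L¹`, uniformly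
for large `n`, by random variables that converge in distribution. -/
lemma tendstoInDistribution_of_approx {T : (n : ℕ) → Ω n → ℝ} {T' : Ω' → ℝ}
    (hT : ∀ n, AEMeasurable (T n) (P n)) (hT' : AEMeasurable T' P')
    (h : ∀ η > 0, ∃ (H : (n : ℕ) → Ω n → ℝ) (H' : Ω' → ℝ),
      TendstoInDistribution H atTop H' P P' ∧
      (∀ n, Integrable (fun ω => T n ω - H n ω) (P n)) ∧
      Integrable (fun ω => T' ω - H' ω) P' ∧
      (∀ᶠ n in atTop, ∫ ω, |T n ω - H n ω| ∂(P n) ≤ η) ∧ ∫ ω, |T' ω - H' ω| ∂P' ≤ η) :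
    TendstoInDistribution T atTop T' P P' where
  forall_aemeasurable := hT
  aemeasurable_limit := hT'
  tendsto := by
    refine tendsto_iff_forall_lipschitz_integral_tendsto.2 ?_
    rintro f ⟨C, hC⟩ ⟨L, hL⟩
    have hmap : ∀ {α : Type _} [MeasurableSpace α] {μ : Measure α} {A : α → ℝ},
        AEMeasurable A μ → ∫ z, f z ∂(μ.map A) = ∫ x, f (A x) ∂μ := fun hA =>
      integral_map hA hL.continuous.aestronglyMeasurable
    simp only [ProbabilityMeasure.coe_mk]
    rw [hmap hT']
    have hmap' : ∀ n, ∫ z, f z ∂((P n).map (T n)) = ∫ x, f (T n x) ∂(P n) := fun n =>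
      integral_map (hT n) hL.continuous.aestronglyMeasurable
    simp only [hmap']
    rw [Metric.tendsto_nhds]
    intro e he
    -- Each of the two `L¹` replacements costs at most `L * η ≤ e / 4`, leaving `e / 2` for the
    -- convergence of `H`.
    set η := e / (4 * ((L : ℝ) + 1)) with hη
    have hL0 : (0 : ℝ) ≤ L := L.2
    have hη0 : 0 < η := by positivity
    obtain ⟨H, H', hH, h1, h2, h3, h4⟩ := h η hη0
    have h5 := (tendsto_iff_forall_lipschitz_integral_tendsto.1 hH.tendsto) f ⟨C, hC⟩ ⟨L, hL⟩
    simp only [ProbabilityMeasure.coe_mk] at h5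
    have hmap'' : ∀ n, ∫ z, f z ∂((P n).map (H n)) = ∫ x, f (H n x) ∂(P n) := fun n =>
      integral_map (hH.forall_aemeasurable n) hL.continuous.aestronglyMeasurable
    rw [hmap hH.aemeasurable_limit] at h5
    simp only [hmap''] at h5
    rw [Metric.tendsto_nhds] at h5
    have hLη : (L : ℝ) * η ≤ e / 4 := by
      rw [hη, mul_div_assoc', div_le_div_iff₀ (by positivity) (by norm_num)]
      nlinarith
    filter_upwards [h3, h5 (e / 2) (by linarith)] with n hn3 hn5
    have a1 := abs_integral_comp_sub_le hC hL (hT n) (hH.forall_aemeasurable n) (h1 n)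
    have a2 := abs_integral_comp_sub_le hC hL hT' hH.aemeasurable_limit h2
    have b1 := a1.trans (mul_le_mul_of_nonneg_left hn3 hL0)
    have b2 := a2.trans (mul_le_mul_of_nonneg_left h4 hL0)
    rw [Real.dist_eq] at hn5 ⊢
    rw [abs_le] at b1 b2
    rw [abs_lt] at hn5 ⊢
    constructor <;> linarith [b1.1, b1.2, b2.1, b2.2, hn5.1, hn5.2]

end Distribution

/-- A random variable of the form `ψ ∘ X`, with `X` in a Polish space, is approximated in
probability by continuous functions of `X`. -/
lemma exists_continuous_measure_lt {Ω S : Type*} [MeasurableSpace Ω] {P : Measure Ω}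
    [IsProbabilityMeasure P] [TopologicalSpace S] [PolishSpace S] [MeasurableSpace S]
    [BorelSpace S] {X : Ω → S} (hX : Measurable X) {ψ : S → ℝ} (hψ : Measurable ψ)
    {ε : ℝ} (hε : 0 < ε) {η : ℝ} (hη : 0 < η) :
    ∃ g : S → ℝ, Continuous g ∧ P.real {ω | ε ≤ |g (X ω) - ψ (X ω)|} ≤ η := by
  let := TopologicalSpace.upgradeIsCompletelyMetrizable S
  set μ := P.map X with hμ
  have : IsProbabilityMeasure μ := Measure.isProbabilityMeasure_map hX.aemeasurable
  -- Truncation makes `ψ` integrable at a cost in probability of at most `η / 2`. Density of bounded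
  -- continuous functions in `L¹` then applies, and the bound `ε / 2 * (η / 2)` is what Markov's
  -- inequality requires.
  set f : ℕ → S → ℝ := fun M x => max (-(M : ℝ)) (min M (ψ x)) with hf
  have hfm : ∀ M, Measurable (f M) := fun M => measurable_const.max (measurable_const.min hψ)
  have htr : TendstoInMeasure μ f atTop ψ := by
    refine tendstoInMeasure_of_tendsto_ae (fun M => (hfm M).aestronglyMeasurable)
      (Eventually.of_forall fun x => ?_)
    refine tendsto_const_nhds.congr' ?_
    obtain ⟨N, hN⟩ := exists_nat_ge |ψ x|
    filter_upwards [eventually_ge_atTop N] with M hM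
    have h1 : |ψ x| ≤ M := hN.trans (by exact_mod_cast hM)
    rw [hf]
    simp only
    rw [min_eq_right (abs_le.1 h1).2, max_eq_right (abs_le.1 h1).1]
  have h0 := tendstoInMeasure_iff_measureReal_norm.1 htr (ε / 2) (by linarith)
  obtain ⟨M, hM⟩ := (h0.eventually (gt_mem_nhds (show (0 : ℝ) < η / 2 by linarith))).exists
  have hint : Integrable (f M) μ := by
    refine (integrable_const (M : ℝ)).mono' (hfm M).aestronglyMeasurable
      (Eventually.of_forall fun x => ?_)
    rw [Real.norm_eq_abs, abs_le]
    exact ⟨le_max_left _ _, max_le (by linarith [(Nat.cast_nonneg M : (0 : ℝ) ≤ M)])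
      (min_le_left _ _)⟩
  obtain ⟨g, hg, hgi⟩ := hint.exists_boundedContinuous_integral_sub_le
    (show 0 < ε / 2 * (η / 2) by positivity)
  refine ⟨g, g.continuous, ?_⟩
  have hmk := mul_meas_ge_le_integral_of_nonneg (μ := μ) (f := fun x => ‖f M x - g x‖)
    (Eventually.of_forall fun x => norm_nonneg _) (hint.sub hgi).norm (ε / 2)
  have h2 : μ.real {x | ε / 2 ≤ ‖f M x - g x‖} ≤ η / 2 :=
    le_of_mul_le_mul_left (hmk.trans hg) (by linarith)
  have hset : MeasurableSet {x | ε ≤ |g x - ψ x|} :=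
    measurableSet_le measurable_const (g.continuous.measurable.sub hψ).abs
  have h3 : P.real {ω | ε ≤ |g (X ω) - ψ (X ω)|} = μ.real {x | ε ≤ |g x - ψ x|} := by
    rw [hμ, map_measureReal_apply hX hset]; rfl
  rw [h3]
  refine (measureReal_mono (s₂ := {x | ε / 2 ≤ ‖f M x - ψ x‖} ∪ {x | ε / 2 ≤ ‖f M x - g x‖})
    ?_).trans ((measureReal_union_le _ _).trans (by linarith))
  intro x hx
  by_contra hcon
  simp only [mem_union, not_or, mem_ofPred_eq, not_le, Real.norm_eq_abs] at hcon hx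
  have := abs_lt.1 hcon.1
  have := abs_lt.1 hcon.2
  have : |g x - ψ x| < ε := abs_lt.2 ⟨by linarith, by linarith⟩
  linarith

/-! ### Conditional probabilities and regular conditional cdfs. -/

section CondProb

variable {Ω S : Type*} [MeasurableSpace Ω] [MeasurableSpace S] {P : Measure Ω}
  {X : Ω → S}

lemma integrable_indicator_one_of_nullMeasurableSet [IsProbabilityMeasure P] {A : Set Ω} (hA : NullMeasurableSet A P) :
    Integrable (A.indicator fun _ => (1 : ℝ)) P :=
  (integrable_const (1 : ℝ)).indicator₀ hA

lemma measurable_condProbGiven (hX : Measurable X) (A : Set Ω) :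
    Measurable (condProbGiven P A X) :=
  (stronglyMeasurable_condExp.measurable).mono hX.comap_le le_rfl

lemma integrable_condProbGiven (A : Set Ω) : Integrable (condProbGiven P A X) P :=
  integrable_condExp

lemma integral_condProbGiven [IsProbabilityMeasure P] (hX : Measurable X) {A : Set Ω} (hA : NullMeasurableSet A P) :
    ∫ ω, condProbGiven P A X ω ∂P = P.real A := by
  rw [condProbGiven, integral_condExp hX.comap_le, integral_indicator₀ hA]
  simp

/-- Monotonicity and subadditivity of conditional probabilities. -/
lemma condProbGiven_le_add [IsProbabilityMeasure P] {A B C : Set Ω} (hA : NullMeasurableSet A P)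
    (hB : NullMeasurableSet B P) (hC : NullMeasurableSet C P)
    (h : ∀ᵐ ω ∂P, ω ∈ A → ω ∈ B ∨ ω ∈ C) :
    ∀ᵐ ω ∂P, condProbGiven P A X ω ≤ condProbGiven P B X ω + condProbGiven P C X ω := by
  have hA' := integrable_indicator_one_of_nullMeasurableSet hA
  have hB' := integrable_indicator_one_of_nullMeasurableSet hB
  have hC' := integrable_indicator_one_of_nullMeasurableSet hC
  have h1 := condExp_mono (m := MeasurableSpace.comap X inferInstance) hA' (hB'.add hC') (by
    filter_upwards [h] with ω hω
    simp only [Pi.add_apply, indicator]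
    split_ifs <;> simp_all)
  filter_upwards [h1, condExp_add hB' hC' (MeasurableSpace.comap X inferInstance)] with ω h1 h2
  rw [h2] at h1
  exact h1

lemma condProbGiven_mono [IsProbabilityMeasure P] {A B : Set Ω} (hA : NullMeasurableSet A P) (hB : NullMeasurableSet B P)
    (h : A ⊆ B) : ∀ᵐ ω ∂P, condProbGiven P A X ω ≤ condProbGiven P B X ω :=
  condExp_mono (integrable_indicator_one_of_nullMeasurableSet hA)
    (integrable_indicator_one_of_nullMeasurableSet hB)
    (Eventually.of_forall (indicator_le_indicator_of_subset h fun _ => zero_le_one))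

/-- Given `X`, the threshold `a (X ω)` is frozen. With `D` in the role of `X` this identifies the
p-value; with `X_n` it evaluates the conditional cdf at an `X_n`-measurable point. -/
lemma condProbGiven_le_eq_condCdf [IsProbabilityMeasure P] (hX : Measurable X) {Y : Ω → ℝ} (hY : Measurable Y) {a : S → ℝ}
    (ha : Measurable a) :
    ∀ᵐ ω ∂P, condProbGiven P {ω | Y ω ≤ a (X ω)} X ω = condCdf P Y X ω (a (X ω)) := by
  have hs : MeasurableSet {p : S × ℝ | p.2 ≤ a p.1} :=
    measurableSet_le measurable_snd (ha.comp measurable_fst)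
  have h := condExp_prod_ae_eq_integral_condDistrib (μ := P) hX hY.aemeasurable
    (f := {p : S × ℝ | p.2 ≤ a p.1}.indicator fun _ => (1 : ℝ))
    (stronglyMeasurable_const.indicator hs)
    ((integrable_const (1 : ℝ)).indicator (hX.prodMk hY hs))
  filter_upwards [h] with ω hω
  have h2 : ∫ y, {p : S × ℝ | p.2 ≤ a p.1}.indicator (fun _ => (1 : ℝ)) (X ω, y)
      ∂(condDistrib Y X P (X ω)) = condCdf P Y X ω (a (X ω)) := by
    have : (fun y => {p : S × ℝ | p.2 ≤ a p.1}.indicator (fun _ => (1 : ℝ)) (X ω, y)) =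
        (Iic (a (X ω))).indicator fun _ => (1 : ℝ) := by
      funext y; simp [indicator]
    rw [this, integral_indicator measurableSet_Iic]
    simp only [integral_const, smul_eq_mul, mul_one, measureReal_restrict_apply_univ]
    exact (cdf_eq_real _ _).symm
  rw [← h2, ← hω]
  rfl

lemma bootPValue_eq_condCdf [IsProbabilityMeasure P] {D : Ω → S} (hD : Measurable D) {t : S → ℝ} (ht : Measurable t)
    {τstar : Ω → ℝ} (hτstar : Measurable τstar) :
    ∀ᵐ ω ∂P, bootPValue P D (fun ω => t (D ω)) τstar ω = condCdf P τstar D ω (t (D ω)) :=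
  condProbGiven_le_eq_condCdf hD hτstar ht

end CondProb
end

/-! ### The sandwich for the conditional law of the p-value. -/

noncomputable section

open CadlagFun

/-- Comparison in `L¹` of `P(p* ≤ q | X)` with a local average of `P(τ ≤ · | X)`
near an `X`-measurable approximation `G` of the `q`-quantile of `P(τ* ≤ · | D)`. -/
lemma integral_abs_condPValueCdf_sub_avg_le {Ω S R : Type*} [MeasurableSpace Ω]
    [MeasurableSpace S] [MeasurableSpace R] {P : Measure Ω} [IsProbabilityMeasure P]
    {D : Ω → S} (hD : Measurable D) {t : S → ℝ} (ht : Measurable t) {τstar : Ω → ℝ}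
    (hτstar : Measurable τstar) {X : Ω → R} (hX : Measurable X) {G : Ω → ℝ}
    (hG : Measurable[MeasurableSpace.comap X inferInstance] G) {q ε : ℝ} (hε : 0 < ε)
    (h1 : AEMeasurable (fun ω =>
      avg (condCdf P (fun ω => t (D ω)) X ω) (G ω + -(3 * ε)) (G ω + -(2 * ε))) P)
    (h2 : AEMeasurable (fun ω =>
      avg (condCdf P (fun ω => t (D ω)) X ω) (G ω + 2 * ε) (G ω + 3 * ε)) P)
    (h3 : AEMeasurable (fun ω =>
      avg (condCdf P τstar D ω) (G ω + -(2 * ε)) (G ω + -ε)) P)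
    (h4 : AEMeasurable (fun ω =>
      avg (condCdf P τstar D ω) (G ω + ε) (G ω + 2 * ε)) P) :
    ∫ ω, |condPValueCdf P D (fun ω => t (D ω)) τstar X q ω -
        avg (condCdf P (fun ω => t (D ω)) X ω) (G ω + -(3 * ε)) (G ω + -(2 * ε))| ∂P ≤
      ∫ ω, (avg (condCdf P (fun ω => t (D ω)) X ω) (G ω + 2 * ε) (G ω + 3 * ε) -
        avg (condCdf P (fun ω => t (D ω)) X ω) (G ω + -(3 * ε)) (G ω + -(2 * ε))) ∂P +
      (P.real {ω | q ≤ avg (condCdf P τstar D ω) (G ω + -(2 * ε)) (G ω + -ε)} +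
        P.real {ω | avg (condCdf P τstar D ω) (G ω + ε) (G ω + 2 * ε) ≤ q}) := by
  -- Doob–Dynkin factorization: `G = h ∘ X`.
  obtain ⟨h, hh, rfl⟩ := hG.exists_eq_measurable_comp
  simp only [Function.comp_apply] at h1 h2 h3 h4 ⊢
  set τ : Ω → ℝ := fun ω => t (D ω) with hτ
  have hτm : Measurable τ := ht.comp hD
  set B1 := {ω | q ≤ avg (condCdf P τstar D ω) (h (X ω) + -(2 * ε)) (h (X ω) + -ε)} with hB1
  set B2 := {ω | avg (condCdf P τstar D ω) (h (X ω) + ε) (h (X ω) + 2 * ε) ≤ q} with hB2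
  have hB1m : NullMeasurableSet B1 P := nullMeasurableSet_le aemeasurable_const h3
  have hB2m : NullMeasurableSet B2 P := nullMeasurableSet_le h4 aemeasurable_const
  have hBm := hB1m.union hB2m
  have hp : MeasurableSet {ω | bootPValue P D τ τstar ω ≤ q} :=
    measurableSet_le (measurable_condProbGiven hD _) measurable_const
  have hlow : MeasurableSet {ω | τ ω ≤ h (X ω) + -(2 * ε)} :=
    measurableSet_le hτm ((hh.comp hX).add_const _)
  have hupp : MeasurableSet {ω | τ ω ≤ h (X ω) + 2 * ε} :=
    measurableSet_le hτm ((hh.comp hX).add_const _)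
  have hcdf : ∀ ω, (condCdf P τstar D ω).IsCDF := fun ω => isCDF_ofStieltjes_cdf _
  have hcdf' : ∀ ω, (condCdf P τ X ω).IsCDF := fun ω => isCDF_ofStieltjes_cdf _
  have hboot := bootPValue_eq_condCdf (P := P) hD ht hτstar
  -- If `τ ≤ G - 2ε` but the p-value, which is the bootstrap cdf at `τ`, exceeds `q`, then so does
  -- that cdf's average over `[G - 2ε, G - ε]`: this is `B1`.
  have key1 := condProbGiven_le_add (X := X) hlow.nullMeasurableSet hp.nullMeasurableSet hBm (by
    filter_upwards [hboot] with ω hω hle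
    by_contra hcon
    simp only [not_or, mem_union, hB1, mem_ofPred_eq, not_le] at hcon hle
    rw [hω] at hcon
    have := (hcdf ω).1 hle
    have := (hcdf ω).le_avg (show h (X ω) + -(2 * ε) < h (X ω) + -ε by linarith)
    linarith [hcon.1, hcon.2.1])
  -- If the p-value is at most `q` while `τ > G + 2ε`, the average over `[G + ε, G + 2ε]` is at most
  -- `q`: this is `B2`.
  have key2 := condProbGiven_le_add (X := X) hp.nullMeasurableSet hupp.nullMeasurableSet hBm (by
    filter_upwards [hboot] with ω hω hle
    by_contra hcon
    simp only [not_or, mem_union, hB2, mem_ofPred_eq, not_le] at hcon hle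
    rw [hω] at hle
    have := (hcdf ω).1 hcon.1.le
    have := (hcdf ω).avg_le (show h (X ω) + ε < h (X ω) + 2 * ε by linarith)
    linarith [hcon.2.2])
  have e1 := condProbGiven_le_eq_condCdf (P := P) hX hτm (hh.add_const (-(2 * ε)))
  have e2 := condProbGiven_le_eq_condCdf (P := P) hX hτm (hh.add_const (2 * ε))
  have i1 : Integrable (fun ω => avg (condCdf P τ X ω) (h (X ω) + -(3 * ε))
      (h (X ω) + -(2 * ε))) P :=
    (integrable_const (1 : ℝ)).mono' h1.aestronglyMeasurable (Eventually.of_forall fun ω => by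
      rw [Real.norm_eq_abs, abs_of_nonneg (avg_nonneg _ (by linarith))]
      exact avg_le_one _ (by linarith))
  have i2 : Integrable (fun ω => avg (condCdf P τ X ω) (h (X ω) + 2 * ε) (h (X ω) + 3 * ε)) P :=
    (integrable_const (1 : ℝ)).mono' h2.aestronglyMeasurable (Eventually.of_forall fun ω => by
      rw [Real.norm_eq_abs, abs_of_nonneg (avg_nonneg _ (by linarith))]
      exact avg_le_one _ (by linarith))
  have iT : Integrable (condPValueCdf P D τ τstar X q) P := integrable_condProbGiven _
  have iB : Integrable (condProbGiven P (B1 ∪ B2) X) P := integrable_condProbGiven _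
  calc _ ≤ ∫ ω, ((avg (condCdf P τ X ω) (h (X ω) + 2 * ε) (h (X ω) + 3 * ε) -
        avg (condCdf P τ X ω) (h (X ω) + -(3 * ε)) (h (X ω) + -(2 * ε))) +
          condProbGiven P (B1 ∪ B2) X ω) ∂P := by
        refine integral_mono_ae (iT.sub i1).abs ((i2.sub i1).add iB) ?_
        filter_upwards [key1, key2, e1, e2] with ω k1 k2 e1 e2
        rw [e1] at k1
        rw [e2] at k2
        have a1 := (hcdf' ω).avg_le (show h (X ω) + -(3 * ε) < h (X ω) + -(2 * ε) by linarith)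
        have a2 := (hcdf' ω).le_avg (show h (X ω) + 2 * ε < h (X ω) + 3 * ε by linarith)
        have a3 := (hcdf' ω).1 (show h (X ω) + -(2 * ε) ≤ h (X ω) + 2 * ε by linarith)
        have k1' : avg (condCdf P τ X ω) (h (X ω) + -(3 * ε)) (h (X ω) + -(2 * ε)) ≤
          condPValueCdf P D τ τstar X q ω + condProbGiven P (B1 ∪ B2) X ω := a1.trans k1
        have k2' : condPValueCdf P D τ τstar X q ω ≤
          avg (condCdf P τ X ω) (h (X ω) + 2 * ε) (h (X ω) + 3 * ε) +
            condProbGiven P (B1 ∪ B2) X ω := by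
          refine le_trans k2 ?_
          gcongr
        rw [abs_le]
        constructor <;> linarith
    _ = _ + P.real (B1 ∪ B2) := by
        rw [← integral_condProbGiven hX hBm]
        exact integral_add (i2.sub i1) iB
    _ ≤ _ := by gcongr; exact measureReal_union_le _ _

lemma measurable_avg_comp {Ω : Type*} [MeasurableSpace Ω] {F : Ω → CadlagFun} (hF : Measurable F)
    {Q : Ω → ℝ} (hQ : Measurable Q) (c d : ℝ) :
    Measurable fun ω => avg (F ω) (Q ω + c) (Q ω + d) := by
  have h : Measurable (Function.uncurry fun a (f : CadlagFun) => cumInt f a) :=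
    measurable_uncurry_of_continuous_of_measurable (fun f => (lipschitzWith_cumInt f).continuous)
      fun a => (continuous_cumInt_left a).measurable
  have h' : ∀ c, Measurable fun ω => cumInt (F ω) (Q ω + c) := fun c =>
    h.comp ((hQ.add_const c).prodMk hF)
  simp only [avg, add_sub_add_left_eq_sub]
  exact ((h' d).sub (h' c)).div_const _

/-- The value at a random point is the limit of the averages over `[Q, Q + 1/(k+1)]`, which are
jointly measurable. -/
lemma aemeasurable_apply_comp {Ω : Type*} [MeasurableSpace Ω] {P : Measure Ω} {F : Ω → CadlagFun}
    (hF : Measurable F) (hFcdf : ∀ᵐ ω ∂P, (F ω).IsCDF ∧ Continuous (F ω)) {Q : Ω → ℝ}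
    (hQ : Measurable Q) : AEMeasurable (fun ω => F ω (Q ω)) P := by
  refine aemeasurable_of_tendsto_metrizable_ae atTop
    (fun k : ℕ => (measurable_avg_comp hF hQ 0 (1 / ((k : ℝ) + 1))).aemeasurable) ?_
  filter_upwards [hFcdf] with ω hω
  have h1 : Tendsto (fun k : ℕ => F ω (Q ω + 1 / ((k : ℝ) + 1))) atTop (𝓝 (F ω (Q ω))) := by
    refine (hω.2.tendsto _).comp ?_
    simpa using (tendsto_one_div_add_atTop_nhds_zero_nat (𝕜 := ℝ)).const_add (Q ω)
  refine tendsto_of_tendsto_of_tendsto_of_le_of_le tendsto_const_nhds h1 (fun k => ?_) fun k => ?_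
  · have := hω.1.le_avg (show Q ω + 0 < Q ω + 1 / ((k : ℝ) + 1) by gcongr; positivity)
    simpa using this
  · exact hω.1.avg_le (by gcongr; positivity)

/-- The limit objects satisfy the smallness requirements for a suitable continuous approximation
of the random quantile. -/
lemma exists_continuous_approx_quantile {Ω S : Type*} [MeasurableSpace Ω] {P : Measure Ω}
    [IsProbabilityMeasure P] {F Fstar : Ω → CadlagFun} (hF : Measurable F)
    (hFcdf : ∀ᵐ ω ∂P, (F ω).IsCDF ∧ Continuous (F ω)) (hFstarcdf : ∀ᵐ ω ∂P, (Fstar ω).IsCDF)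
    [TopologicalSpace S] [PolishSpace S] [MeasurableSpace S] [BorelSpace S] {X : Ω → S}
    (hX : Measurable X) (hFstarX : ∃ φ : S → CadlagFun, Measurable φ ∧ ∀ᵐ ω ∂P, Fstar ω = φ (X ω))
    {q : ℝ} (hq : q ∈ Ioo (0 : ℝ) 1) (hgood : ∀ r : ℚ, ∀ᵐ ω ∂P, Fstar ω r ≠ q)
    {η : ℝ} (hη : 0 < η) :
    ∃ (ε : ℝ) (g : S → ℝ), 0 < ε ∧ Continuous g ∧
      P.real {ω | q ≤ avg (Fstar ω) (g (X ω) + -(2 * ε)) (g (X ω) + -ε)} ≤ η ∧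
      P.real {ω | avg (Fstar ω) (g (X ω) + ε) (g (X ω) + 2 * ε) ≤ q} ≤ η ∧
      ∫ ω, (avg (F ω) (g (X ω) + 2 * ε) (g (X ω) + 3 * ε) -
        avg (F ω) (g (X ω) + -(3 * ε)) (g (X ω) + -(2 * ε))) ∂P ≤ 2 * η ∧
      ∫ ω, |F ω (genInv (Fstar ω) q) -
        avg (F ω) (g (X ω) + -(3 * ε)) (g (X ω) + -(2 * ε))| ∂P ≤ 2 * η := by
  obtain ⟨φ, hφ, hφX⟩ := hFstarX
  set ψ : S → ℝ := fun x => quantile q (φ x) with hψdef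
  have hψ : Measurable ψ := (measurable_quantile q).comp hφ
  have hQ : Measurable fun ω => ψ (X ω) := hψ.comp hX
  have hQeq : ∀ᵐ ω ∂P, genInv (Fstar ω) q = ψ (X ω) := by
    filter_upwards [hφX, hFstarcdf] with ω h1 h2
    rw [hψdef]
    simp only
    rw [← h1, h2.quantile_eq hq]
  -- `Δ ε` bounds the oscillation of `F` over `[ψ - 4ε, ψ + 4ε]`, which contains `[g - 3ε, g + 3ε]`
  -- when `|g - ψ| < ε`. It is centred at `ψ`, so `ε` can be fixed before `g` is chosen.
  set Δ : ℝ → Ω → ℝ := fun ε ω => avg (F ω) (ψ (X ω) + 4 * ε) (ψ (X ω) + 5 * ε) -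
    avg (F ω) (ψ (X ω) + -(5 * ε)) (ψ (X ω) + -(4 * ε)) with hΔ
  have hΔm : ∀ ε, Measurable (Δ ε) := fun ε =>
    (measurable_avg_comp hF hQ _ _).sub (measurable_avg_comp hF hQ _ _)
  have hΔ1 : ∀ ε > 0, ∀ ω, ‖Δ ε ω‖ ≤ 1 := by
    intro ε hε ω
    have a1 := avg_nonneg (F ω) (show ψ (X ω) + 4 * ε < ψ (X ω) + 5 * ε by linarith)
    have a2 := avg_le_one (F ω) (show ψ (X ω) + 4 * ε < ψ (X ω) + 5 * ε by linarith)
    have a3 := avg_nonneg (F ω) (show ψ (X ω) + -(5 * ε) < ψ (X ω) + -(4 * ε) by linarith)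
    have a4 := avg_le_one (F ω) (show ψ (X ω) + -(5 * ε) < ψ (X ω) + -(4 * ε) by linarith)
    rw [Real.norm_eq_abs, abs_le, hΔ]
    constructor <;> simp only <;> linarith
  have hlim : Tendsto (fun k : ℕ => ∫ ω, Δ (1 / ((k : ℝ) + 1)) ω ∂P) atTop (𝓝 0) := by
    have : (0 : ℝ) = ∫ _, (0 : ℝ) ∂P := by simp
    rw [this]
    refine tendsto_integral_of_dominated_convergence (fun _ => 1)
      (fun k => (hΔm _).aestronglyMeasurable) (integrable_const _)
      (fun k => Eventually.of_forall (hΔ1 _ (by positivity))) ?_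
    filter_upwards [hFcdf] with ω hω
    have e0 : Tendsto (fun k : ℕ => 1 / ((k : ℝ) + 1)) atTop (𝓝 0) :=
      tendsto_one_div_add_atTop_nhds_zero_nat
    have e1 : Continuous fun ε : ℝ => F ω (ψ (X ω) + 5 * ε) - F ω (ψ (X ω) + -(5 * ε)) :=
      (hω.2.comp (by fun_prop)).sub (hω.2.comp (by fun_prop))
    have e2 := (e1.tendsto 0).comp e0
    simp only [mul_zero, neg_zero, sub_self] at e2
    refine tendsto_of_tendsto_of_tendsto_of_le_of_le tendsto_const_nhds e2 (fun k => ?_) fun k => ?_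
    · have hε : 0 < 1 / ((k : ℝ) + 1) := by positivity
      set ε := 1 / ((k : ℝ) + 1)
      have a1 := hω.1.le_avg (show ψ (X ω) + 4 * ε < ψ (X ω) + 5 * ε by linarith)
      have a2 := hω.1.avg_le (show ψ (X ω) + -(5 * ε) < ψ (X ω) + -(4 * ε) by linarith)
      have a3 := hω.1.1 (show ψ (X ω) + -(4 * ε) ≤ ψ (X ω) + 4 * ε by linarith)
      simp only [hΔ]
      linarith
    · have hε : 0 < 1 / ((k : ℝ) + 1) := by positivity
      simp only [Function.comp_apply]
      set ε := 1 / ((k : ℝ) + 1)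
      have a1 := hω.1.avg_le (show ψ (X ω) + 4 * ε < ψ (X ω) + 5 * ε by linarith)
      have a2 := hω.1.le_avg (show ψ (X ω) + -(5 * ε) < ψ (X ω) + -(4 * ε) by linarith)
      simp only [hΔ]
      linarith
  obtain ⟨k, hk⟩ := (hlim.eventually (gt_mem_nhds hη)).exists
  have hε : 0 < 1 / ((k : ℝ) + 1) := by positivity
  set ε := 1 / ((k : ℝ) + 1)
  obtain ⟨g, hg, hgP⟩ := exists_continuous_measure_lt (P := P) hX hψ hε hη
  set A := {ω | ε ≤ |g (X ω) - ψ (X ω)|} with hA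
  have hgX : Measurable fun ω => g (X ω) := hg.measurable.comp hX
  have hAm : MeasurableSet A := measurableSet_le measurable_const (hgX.sub hQ).abs
  have iΔ : Integrable (Δ ε) P := (integrable_const (1 : ℝ)).mono' (hΔm ε).aestronglyMeasurable
    (Eventually.of_forall (hΔ1 ε hε))
  have iA : Integrable (A.indicator fun _ => (1 : ℝ)) P := (integrable_const 1).indicator hAm
  -- One `η` for the oscillation, one for the event `A` where `g` misses `ψ`; on `A` the integrands
  -- are bounded by `1`.
  have hbound : ∫ ω, (Δ ε ω + A.indicator (fun _ => (1 : ℝ)) ω) ∂P ≤ 2 * η := by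
    rw [integral_add iΔ iA, integral_indicator hAm]
    simp only [integral_const, smul_eq_mul, mul_one, measureReal_restrict_apply_univ]
    linarith
  have m1 := measurable_avg_comp hF hgX (-(3 * ε)) (-(2 * ε))
  have m2 := measurable_avg_comp hF hgX (2 * ε) (3 * ε)
  have i1 : Integrable (fun ω => avg (F ω) (g (X ω) + -(3 * ε)) (g (X ω) + -(2 * ε))) P :=
    (integrable_const (1 : ℝ)).mono' m1.aestronglyMeasurable (Eventually.of_forall fun ω => by
      rw [Real.norm_eq_abs, abs_of_nonneg (avg_nonneg _ (by linarith))]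
      exact avg_le_one _ (by linarith))
  have i2 : Integrable (fun ω => avg (F ω) (g (X ω) + 2 * ε) (g (X ω) + 3 * ε)) P :=
    (integrable_const (1 : ℝ)).mono' m2.aestronglyMeasurable (Eventually.of_forall fun ω => by
      rw [Real.norm_eq_abs, abs_of_nonneg (avg_nonneg _ (by linarith))]
      exact avg_le_one _ (by linarith))
  have i3 : Integrable (fun ω => F ω (genInv (Fstar ω) q)) P := by
    refine (integrable_const (1 : ℝ)).mono' ?_ ?_
    · refine AEMeasurable.aestronglyMeasurable ((aemeasurable_apply_comp hF hFcdf hQ).congr ?_)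
      filter_upwards [hQeq] with ω h
      rw [h]
    · filter_upwards [hFcdf] with ω h
      rw [Real.norm_eq_abs, abs_of_nonneg (h.1.nonneg _)]
      exact h.1.le_one _
  have hnear : ∀ ω ∉ A, ψ (X ω) - ε < g (X ω) ∧ g (X ω) < ψ (X ω) + ε := by
    intro ω hω
    have h1 : |g (X ω) - ψ (X ω)| < ε := not_le.1 hω
    have := abs_lt.1 h1
    constructor <;> linarith
  refine ⟨ε, g, hε, hg, ?_, ?_, ?_, ?_⟩
  · refine le_trans (ENNReal.toReal_mono (measure_ne_top P A) (measure_mono_ae ?_)) hgP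
    filter_upwards [hQeq, hFstarcdf, ae_all_iff.2 hgood] with ω h1 h2 h3 h4
    by_contra hcon
    obtain ⟨n1, n2⟩ := hnear ω hcon
    have h5 : q ≤ avg (Fstar ω) (g (X ω) + -(2 * ε)) (g (X ω) + -ε) := h4
    have h6 := h2.avg_le (show g (X ω) + -(2 * ε) < g (X ω) + -ε by linarith)
    -- A rational between `g - ε` and the quantile would be a point where `Fstar` equals `q`, which
    -- `hgood` excludes. On the upper side no such condition is needed: right of the inverse the cdf
    -- strictly exceeds `q`.
    obtain ⟨r, hr1, hr2⟩ := exists_rat_btwn (show g (X ω) + -ε < ψ (X ω) by linarith)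
    rw [← h1] at hr2
    have h7 := h2.le_of_lt_genInv hq.1 hr2
    have h8 := h2.1 hr1.le
    exact h3 r (le_antisymm h7 (h5.trans (h6.trans h8)))
  · refine le_trans (ENNReal.toReal_mono (measure_ne_top P A) (measure_mono_ae ?_)) hgP
    filter_upwards [hQeq, hFstarcdf] with ω h1 h2 h4
    by_contra hcon
    obtain ⟨n1, n2⟩ := hnear ω hcon
    have h5 : avg (Fstar ω) (g (X ω) + ε) (g (X ω) + 2 * ε) ≤ q := h4
    have h6 := h2.le_avg (show g (X ω) + ε < g (X ω) + 2 * ε by linarith)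
    have h7 := h2.lt_of_genInv_lt hq.2 (show genInv (Fstar ω) q < g (X ω) + ε by
      rw [h1]; linarith)
    linarith
  · refine le_trans (integral_mono_ae (i2.sub i1) (iΔ.add iA) ?_) hbound
    filter_upwards [hFcdf] with ω hω
    simp only [Pi.add_apply]
    have b1 := hω.1.avg_le (show g (X ω) + 2 * ε < g (X ω) + 3 * ε by linarith)
    have b2 := hω.1.le_avg (show g (X ω) + -(3 * ε) < g (X ω) + -(2 * ε) by linarith)
    by_cases hωA : ω ∈ A
    · have a3 := avg_nonneg (F ω) (show g (X ω) + -(3 * ε) < g (X ω) + -(2 * ε) by linarith)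
      have a4 := avg_le_one (F ω) (show g (X ω) + 2 * ε < g (X ω) + 3 * ε by linarith)
      have a1 := hω.1.le_avg (show ψ (X ω) + 4 * ε < ψ (X ω) + 5 * ε by linarith)
      have a2 := hω.1.avg_le (show ψ (X ω) + -(5 * ε) < ψ (X ω) + -(4 * ε) by linarith)
      have a5 := hω.1.1 (show ψ (X ω) + -(4 * ε) ≤ ψ (X ω) + 4 * ε by linarith)
      simp only [hΔ, indicator_of_mem hωA]
      linarith
    · obtain ⟨n1, n2⟩ := hnear ω hωA
      have a1 := hω.1.le_avg (show ψ (X ω) + 4 * ε < ψ (X ω) + 5 * ε by linarith)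
      have a2 := hω.1.avg_le (show ψ (X ω) + -(5 * ε) < ψ (X ω) + -(4 * ε) by linarith)
      have a5 := hω.1.1 (show ψ (X ω) + -(4 * ε) ≤ g (X ω) + -(3 * ε) by linarith)
      have a6 := hω.1.1 (show g (X ω) + 3 * ε ≤ ψ (X ω) + 4 * ε by linarith)
      simp only [hΔ, indicator_of_notMem hωA]
      linarith
  · refine le_trans (integral_mono_ae (i3.sub i1).abs (iΔ.add iA) ?_) hbound
    filter_upwards [hFcdf, hQeq] with ω hω h1
    simp only [Pi.add_apply]
    rw [h1]
    have b1 := hω.1.avg_le (show g (X ω) + -(3 * ε) < g (X ω) + -(2 * ε) by linarith)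
    have b2 := hω.1.le_avg (show g (X ω) + -(3 * ε) < g (X ω) + -(2 * ε) by linarith)
    have a1 := hω.1.le_avg (show ψ (X ω) + 4 * ε < ψ (X ω) + 5 * ε by linarith)
    have a2 := hω.1.avg_le (show ψ (X ω) + -(5 * ε) < ψ (X ω) + -(4 * ε) by linarith)
    by_cases hωA : ω ∈ A
    · have a3 := avg_nonneg (F ω) (show g (X ω) + -(3 * ε) < g (X ω) + -(2 * ε) by linarith)
      have a4 := avg_le_one (F ω) (show g (X ω) + -(3 * ε) < g (X ω) + -(2 * ε) by linarith)
      have a5 := hω.1.1 (show ψ (X ω) + -(4 * ε) ≤ ψ (X ω) + 4 * ε by linarith)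
      have a6 := hω.1.nonneg (ψ (X ω))
      have a7 := hω.1.le_one (ψ (X ω))
      simp only [hΔ, indicator_of_mem hωA]
      rw [abs_le]
      constructor <;> linarith
    · obtain ⟨n1, n2⟩ := hnear ω hωA
      have a5 := hω.1.1 (show ψ (X ω) + -(4 * ε) ≤ g (X ω) + -(3 * ε) by linarith)
      have a6 := hω.1.1 (show g (X ω) + -(2 * ε) ≤ ψ (X ω) by linarith)
      have a7 := hω.1.1 (show ψ (X ω) ≤ ψ (X ω) + 4 * ε by linarith)
      simp only [hΔ, indicator_of_notMem hωA]
      rw [abs_le]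
      constructor <;> linarith
end

/-! ### Convergence at non-flat levels, and recovery of the cdf from its quantiles. -/

noncomputable section

open CadlagFun

/-- For `q > g u` the inverse lies at or right of `u`, so `f u ≤ q`; for `q < g u` it lies at or
left of `u`, so `f u ≥ q`. Let `q` approach `g u` through `s`. -/
lemma CadlagFun.eq_of_apply_genInv {f g : CadlagFun} (hf : f.IsCDF) (hg : g.IsCDF) {s : Set ℝ}
    (hs : Dense s) (h : ∀ q ∈ s, q ∈ Ioo (0 : ℝ) 1 → f (genInv g q) = q) : f = g := by
  refine ext_toFun fun u => le_antisymm ?_ ?_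
  · refine le_of_forall_gt_imp_ge_of_dense fun a ha => ?_
    rcases le_or_gt 1 a with h1 | h1
    · exact (hf.le_one u).trans h1
    · obtain ⟨q, hq, h2, h3⟩ := hs.exists_between ha
      have hq1 : q ∈ Ioo (0 : ℝ) 1 := ⟨(hg.nonneg u).trans_lt h2, h3.trans h1⟩
      have := hf.1 (hg.le_genInv hq1.2 h2.le)
      rw [h q hq hq1] at this
      exact this.trans h3.le
  · refine le_of_forall_lt_imp_le_of_dense fun a ha => ?_
    rcases le_or_gt a 0 with h1 | h1
    · exact h1.trans (hf.nonneg u)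
    · obtain ⟨q, hq, h2, h3⟩ := hs.exists_between ha
      have hq1 : q ∈ Ioo (0 : ℝ) 1 := ⟨h1.trans h2, h3.trans_le (hg.le_one u)⟩
      have hle : genInv g q ≤ u := csSup_le (hg.nonempty_le hq1.1) fun v hv =>
        le_of_not_gt fun hc => h3.not_ge ((hg.1 hc.le).trans hv)
      have := hf.1 hle
      rw [h q hq hq1] at this
      exact h2.le.trans this

/-- Outside a countable set of levels `q`, the paths of a random cdf are almost surely not flat
at the level `q`. -/
lemma countable_flat_level {Ω : Type*} [MeasurableSpace Ω] {P : Measure Ω} [IsProbabilityMeasure P]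
    {F : Ω → CadlagFun} (hF : Measurable F) (hFcdf : ∀ᵐ ω ∂P, (F ω).IsCDF ∧ Continuous (F ω)) :
    ∃ B : Set ℝ, B.Countable ∧ ∀ q ∉ B, ∀ r : ℚ, ∀ᵐ ω ∂P, F ω r ≠ q := by
  -- Rational points suffice, since a monotone path flat at `q` on an interval takes the value `q`
  -- at a rational. Each `F r` has countably many atoms.
  refine ⟨⋃ r : ℚ, {q | 0 < P {ω | F ω r = q}}, countable_iUnion fun r =>
    Measure.countable_meas_level_set_pos₀
      (aemeasurable_apply_comp hF hFcdf measurable_const).nullMeasurable, fun q hq r => ?_⟩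
  rw [ae_iff]
  simp only [ne_eq, not_not]
  by_contra hne
  exact hq (mem_iUnion.2 ⟨r, pos_iff_ne_zero.2 hne⟩)

section Bootstrap

variable {Ω : ℕ → Type*} [∀ n, MeasurableSpace (Ω n)]
  {P : (n : ℕ) → Measure (Ω n)} [∀ n, IsProbabilityMeasure (P n)]
  {SD SX : ℕ → Type*} [∀ n, MeasurableSpace (SD n)] [∀ n, MeasurableSpace (SX n)]
  {D : (n : ℕ) → Ω n → SD n} {t : (n : ℕ) → SD n → ℝ} {τstar : (n : ℕ) → Ω n → ℝ}
  {X : (n : ℕ) → Ω n → SX n} {Ω' : Type*} [MeasurableSpace Ω'] {P' : Measure Ω'}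
  [IsProbabilityMeasure P'] {F Fstar : Ω' → CadlagFun}
  {S' : Type*} [TopologicalSpace S'] {X' : Ω' → S'} {Xn' : (n : ℕ) → Ω n → S'}

/-- Weak convergence of `P(p* ≤ q | X)` at a level `q` at which the limiting bootstrap cdf is
almost surely not flat. -/
theorem tendstoInDistribution_condPValueCdf [PolishSpace S'] [MeasurableSpace S'] [BorelSpace S']
    (hD : ∀ n, Measurable (D n)) (ht : ∀ n, Measurable (t n)) (hτstar : ∀ n, Measurable (τstar n))
    (hX : ∀ n, Measurable (X n)) (hF : Measurable F)
    (hFcdf : ∀ᵐ ω ∂P', (F ω).IsCDF ∧ Continuous (F ω)) (hFstarcdf : ∀ᵐ ω ∂P', (Fstar ω).IsCDF)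
    (hX' : Measurable X')
    (hFstarX' : ∃ φ : S' → CadlagFun, Measurable φ ∧ ∀ᵐ ω ∂P', Fstar ω = φ (X' ω))
    (hXn' : ∀ n, Measurable[MeasurableSpace.comap (X n) inferInstance] (Xn' n))
    (hconv : TendstoWeakly
      (fun n ω => (condCdf (P n) (fun ω => t n (D n ω)) (X n) ω, condCdf (P n) (τstar n) (D n) ω,
        Xn' n ω)) (fun ω => (F ω, Fstar ω, X' ω)) P P')
    {q : ℝ} (hq : q ∈ Ioo (0 : ℝ) 1) (hgood : ∀ r : ℚ, ∀ᵐ ω ∂P', Fstar ω r ≠ q) :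
    TendstoInDistribution
      (fun n => condPValueCdf (P n) (D n) (fun ω => t n (D n ω)) (τstar n) (X n) q) atTop
      (fun ω => F ω (genInv (Fstar ω) q)) P P' := by
  have hT' : AEMeasurable (fun ω => F ω (genInv (Fstar ω) q)) P' := by
    obtain ⟨φ, hφ, hφX⟩ := hFstarX'
    refine (aemeasurable_apply_comp hF hFcdf (((measurable_quantile q).comp hφ).comp hX')).congr ?_
    filter_upwards [hφX, hFstarcdf] with ω h1 h2
    simp only [Function.comp_apply]
    rw [← h1, h2.quantile_eq hq]
  have hTm : ∀ n, Measurable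
      (condPValueCdf (P n) (D n) (fun ω => t n (D n ω)) (τstar n) (X n) q) := fun n =>
    measurable_condProbGiven (hX n) _
  refine tendstoInDistribution_of_approx (fun n => (hTm n).aemeasurable) hT' fun η hη => ?_
  -- The final bound is `η / 2` for the oscillation plus `2 * (η / 12)` for each bad event; the
  -- limit bounds are doubled or relaxed so that the portmanteau inequalities are strict.
  have hη12 : 0 < η / 12 := by linarith
  obtain ⟨ε, g, hε, hg, b1, b2, b3, b4⟩ :=
    exists_continuous_approx_quantile hF hFcdf hFstarcdf hX' hFstarX' hq hgood hη12
  have c1 : ∀ c d, Continuous fun z : CadlagFun × CadlagFun × S' =>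
      avg z.1 (g z.2.2 + c) (g z.2.2 + d) := fun c d =>
    continuous_avg_add continuous_fst (hg.comp (continuous_snd.comp continuous_snd)) c d
  have c2 : ∀ c d, Continuous fun z : CadlagFun × CadlagFun × S' =>
      avg z.2.1 (g z.2.2 + c) (g z.2.2 + d) := fun c d =>
    continuous_avg_add (continuous_fst.comp continuous_snd)
      (hg.comp (continuous_snd.comp continuous_snd)) c d
  have w1 := hconv.continuous_comp (c1 (-(3 * ε)) (-(2 * ε)))
  have w2 := hconv.continuous_comp (c1 (2 * ε) (3 * ε))
  have w3 := hconv.continuous_comp (c2 (-(2 * ε)) (-ε))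
  have w4 := hconv.continuous_comp (c2 ε (2 * ε))
  refine ⟨_, _, w1, fun n => ?_, ?_, ?_, b4.trans (by linarith)⟩
  · refine (integrable_condProbGiven _).sub ((integrable_const (1 : ℝ)).mono'
      (w1.forall_aemeasurable n).aestronglyMeasurable (Eventually.of_forall fun ω => ?_))
    rw [Real.norm_eq_abs, abs_of_nonneg (avg_nonneg _ (by linarith))]
    exact avg_le_one _ (by linarith)
  · refine Integrable.sub ?_ ((integrable_const (1 : ℝ)).mono'
      w1.aemeasurable_limit.aestronglyMeasurable (Eventually.of_forall fun ω => ?_))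
    · refine (integrable_const (1 : ℝ)).mono' hT'.aestronglyMeasurable ?_
      filter_upwards [hFcdf] with ω h
      rw [Real.norm_eq_abs, abs_of_nonneg (h.1.nonneg _)]
      exact h.1.le_one _
    · rw [Real.norm_eq_abs, abs_of_nonneg (avg_nonneg _ (by linarith))]
      exact avg_le_one _ (by linarith)
  · have v3 := w3.eventually_measure_closed_lt (isClosed_Ici (a := q))
      (c := ENNReal.ofReal (2 * (η / 12))) (by
        refine (ENNReal.lt_ofReal_iff_toReal_lt (measure_ne_top _ _)).2 ?_
        exact lt_of_le_of_lt b1 (by linarith))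
    have v4 := w4.eventually_measure_closed_lt (isClosed_Iic (a := q))
      (c := ENNReal.ofReal (2 * (η / 12))) (by
        refine (ENNReal.lt_ofReal_iff_toReal_lt (measure_ne_top _ _)).2 ?_
        exact lt_of_le_of_lt b2 (by linarith))
    have c5 : Continuous fun z : CadlagFun × CadlagFun × S' =>
        avg z.1 (g z.2.2 + 2 * ε) (g z.2.2 + 3 * ε) -
          avg z.1 (g z.2.2 + -(3 * ε)) (g z.2.2 + -(2 * ε)) := (c1 _ _).sub (c1 _ _)
    have v5 := (hconv.tendsto_integral c5
      (C := 1) fun z => by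
        have a1 := avg_nonneg z.1 (show g z.2.2 + 2 * ε < g z.2.2 + 3 * ε by linarith)
        have a2 := avg_le_one z.1 (show g z.2.2 + 2 * ε < g z.2.2 + 3 * ε by linarith)
        have a3 := avg_nonneg z.1 (show g z.2.2 + -(3 * ε) < g z.2.2 + -(2 * ε) by linarith)
        have a4 := avg_le_one z.1 (show g z.2.2 + -(3 * ε) < g z.2.2 + -(2 * ε) by linarith)
        rw [Real.norm_eq_abs, abs_le]
        constructor <;> linarith).eventually (gt_mem_nhds (b3.trans_lt
        (show 2 * (η / 12) < η / 2 by linarith)))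
    filter_upwards [v3, v4, v5] with n v3 v4 v5
    have hle := integral_abs_condPValueCdf_sub_avg_le (P := P n) (hD n) (ht n) (hτstar n) (hX n)
      (G := fun ω => g (Xn' n ω)) (hg.measurable.comp (hXn' n)) (q := q) hε (w1.forall_aemeasurable n)
      (w2.forall_aemeasurable n) (w3.forall_aemeasurable n) (w4.forall_aemeasurable n)
    refine hle.trans ?_
    have u3 := ENNReal.toReal_mono ENNReal.ofReal_ne_top v3.le
    have u4 := ENNReal.toReal_mono ENNReal.ofReal_ne_top v4.le
    rw [ENNReal.toReal_ofReal (by linarith)] at u3 u4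
    have u3' : (P n).real {ω | q ≤ avg (condCdf (P n) (τstar n) (D n) ω)
      (g (Xn' n ω) + -(2 * ε)) (g (Xn' n ω) + -ε)} ≤ 2 * (η / 12) := u3
    have u4' : (P n).real {ω | avg (condCdf (P n) (τstar n) (D n) ω)
      (g (Xn' n ω) + ε) (g (Xn' n ω) + 2 * ε) ≤ q} ≤ 2 * (η / 12) := u4
    linarith
end Bootstrap
end

/-! ### A continuous majorant of the uniform distance between cdfs. -/

noncomputable section

namespace CadlagFun

/-- Averages of `f` over the intervals `[i/(k+1), (i+1)/(k+1)]`, for `|i| ≤ (k+1)²`, extended by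
`0` and `1`. -/
def gridAvg (k : ℕ) (i : ℤ) (f : CadlagFun) : ℝ :=
  if i < -((k : ℤ) + 1) ^ 2 then 0 else if ((k : ℤ) + 1) ^ 2 < i then 1 else
    avg f (i / ((k : ℝ) + 1)) ((i + 1) / ((k : ℝ) + 1))

lemma continuous_gridAvg (k : ℕ) (i : ℤ) : Continuous (gridAvg k i) := by
  unfold gridAvg
  split_ifs
  · exact continuous_const
  · exact continuous_const
  · exact continuous_avg_left _ _

lemma grid_lt (k : ℕ) (i : ℤ) : (i : ℝ) / ((k : ℝ) + 1) < (i + 1) / ((k : ℝ) + 1) := by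
  gcongr; linarith

lemma IsCDF.le_gridAvg {f : CadlagFun} (hf : f.IsCDF) {k : ℕ} {i : ℤ}
    (hi : -((k : ℤ) + 1) ^ 2 ≤ i) {u : ℝ}
    (hu : u ≤ i / ((k : ℝ) + 1) ∨ ((k : ℤ) + 1) ^ 2 < i) : f u ≤ gridAvg k i f := by
  unfold gridAvg
  rw [if_neg hi.not_gt]
  split_ifs with h
  · exact hf.le_one u
  · exact (hf.1 (hu.resolve_right h)).trans (hf.le_avg (grid_lt k i))

lemma IsCDF.gridAvg_le {f : CadlagFun} (hf : f.IsCDF) {k : ℕ} {i : ℤ}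
    (hi : i ≤ ((k : ℤ) + 1) ^ 2) {u : ℝ}
    (hu : (i + 1) / ((k : ℝ) + 1) ≤ u ∨ i < -((k : ℤ) + 1) ^ 2) : gridAvg k i f ≤ f u := by
  unfold gridAvg
  split_ifs with h h'
  · exact hf.nonneg u
  · exact absurd h' hi.not_gt
  · exact (hf.avg_le (grid_lt k i)).trans (hf.1 (hu.resolve_right h))

/-- A continuous functional bounding the uniform distance between two cdfs. -/
def gridGap (k : ℕ) (f g : CadlagFun) : ℝ :=
  (Finset.Icc (-((k : ℤ) + 1) ^ 2 - 1) (((k : ℤ) + 1) ^ 2 + 1)).sup'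
    (Finset.nonempty_Icc.2 (by nlinarith [sq_nonneg ((k : ℤ) + 1)])) fun i =>
      max (gridAvg k (i + 1) f - gridAvg k (i - 1) g) (gridAvg k (i + 1) g - gridAvg k (i - 1) f)

lemma continuous_gridGap (k : ℕ) : Continuous fun p : CadlagFun × CadlagFun =>
    gridGap k p.1 p.2 := by
  unfold gridGap
  refine Continuous.finset_sup'_apply _ fun i _ => ?_
  have h1 : ∀ j, Continuous fun p : CadlagFun × CadlagFun => gridAvg k j p.1 := fun j =>
    (continuous_gridAvg k j).comp continuous_fst
  have h2 : ∀ j, Continuous fun p : CadlagFun × CadlagFun => gridAvg k j p.2 := fun j =>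
    (continuous_gridAvg k j).comp continuous_snd
  exact ((h1 _).sub (h2 _)).max ((h2 _).sub (h1 _))

/-- By monotonicity, the value at a point of cell `i` lies between the averages over cells `i - 1`
and `i + 1`, for both cdfs. -/
lemma abs_sub_le_gridGap {f g : CadlagFun} (hf : f.IsCDF) (hg : g.IsCDF) (k : ℕ) (u : ℝ) :
    |f u - g u| ≤ gridGap k f g := by
  have hκ : (0 : ℝ) < (k : ℝ) + 1 := by positivity
  set N : ℤ := ((k : ℤ) + 1) ^ 2 with hN
  have hN0 : 0 ≤ N := sq_nonneg _
  set i₀ : ℤ := ⌊u * ((k : ℝ) + 1)⌋ with hi₀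
  -- Clamping one step beyond `±N` makes a neighbouring index fall in the tail, where `gridAvg` is
  -- the trivial bound `0` or `1`.
  set i : ℤ := max (-N - 1) (min (N + 1) i₀) with hi
  have hmem : i ∈ Finset.Icc (-N - 1) (N + 1) := by
    rw [Finset.mem_Icc]; omega
  have hlow : (i₀ : ℝ) / ((k : ℝ) + 1) ≤ u := by
    rw [div_le_iff₀ hκ]; exact Int.floor_le _
  have hupp : u ≤ (i₀ + 1) / ((k : ℝ) + 1) := by
    rw [le_div_iff₀ hκ]; exact (Int.lt_floor_add_one _).le
  have hA : ∀ {f : CadlagFun}, f.IsCDF → f u ≤ gridAvg k (i + 1) f := by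
    intro f hf
    refine hf.le_gridAvg (by rw [← hN]; omega) ?_
    rcases le_or_gt i₀ i with h | h
    · left
      refine hupp.trans ?_
      push_cast
      have : (i₀ : ℝ) ≤ i := by exact_mod_cast h
      gcongr
    · right; rw [← hN]; omega
  have hB : ∀ {f : CadlagFun}, f.IsCDF → gridAvg k (i - 1) f ≤ f u := by
    intro f hf
    refine hf.gridAvg_le (by rw [← hN]; omega) ?_
    rcases le_or_gt i i₀ with h | h
    · left
      refine le_trans ?_ hlow
      push_cast
      have : (i : ℝ) ≤ i₀ := by exact_mod_cast h
      rw [sub_add_cancel]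
      gcongr
    · right; rw [← hN]; omega
  have hsup : max (gridAvg k (i + 1) f - gridAvg k (i - 1) g)
      (gridAvg k (i + 1) g - gridAvg k (i - 1) f) ≤ gridGap k f g :=
    Finset.le_sup' (fun i => max (gridAvg k (i + 1) f - gridAvg k (i - 1) g)
      (gridAvg k (i + 1) g - gridAvg k (i - 1) f)) hmem
  have := hA hf
  have := hA hg
  have := hB hf
  have := hB hg
  obtain ⟨s1, s2⟩ := max_le_iff.1 hsup
  rw [abs_le]
  constructor <;> linarith

/-- A continuous cdf is uniformly continuous. -/
lemma IsCDF.exists_modulus {f : CadlagFun} (hf : f.IsCDF) (hc : Continuous f) {η : ℝ} (hη : 0 < η) :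
    ∃ δ > 0, ∀ a b, a ≤ b → b ≤ a + δ → f b - f a ≤ η := by
  obtain ⟨l, hl⟩ := (hf.2.1.eventually (gt_mem_nhds hη)).exists
  obtain ⟨r, hr⟩ := (hf.2.2.eventually (lt_mem_nhds (show 1 - η < 1 by linarith))).exists
  have huc := isCompact_Icc.uniformContinuousOn_of_continuous (s := Icc (l - 1) (r + 1))
    hc.continuousOn
  rw [Metric.uniformContinuousOn_iff_le] at huc
  obtain ⟨δ, hδ, h⟩ := huc η hη
  refine ⟨min δ 1, by positivity, fun a b hab hba => ?_⟩
  have h1 : b ≤ a + δ := hba.trans (by gcongr; exact min_le_left _ _)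
  have h2 : b ≤ a + 1 := hba.trans (by gcongr; exact min_le_right _ _)
  rcases le_or_gt b l with hbl | hbl
  · have := hf.1 hbl
    have := hf.nonneg a
    linarith
  rcases le_or_gt r a with har | har
  · have := hf.1 har
    have := hf.le_one b
    linarith
  have := h b ⟨by linarith, by linarith⟩ a ⟨by linarith, by linarith⟩ (by
    rw [Real.dist_eq, abs_of_nonneg (by linarith)]; linarith)
  rw [Real.dist_eq] at this
  exact (le_abs_self _).trans this

/-- Cells `i - 1` to `i + 1` span length `3/(k+1)`, so uniform continuity costs `e / 4`; replacing
`f` by `0` or `1` beyond `±(k+1)` costs at most `e / 4` on each side. -/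
lemma IsCDF.tendsto_gridGap {f : CadlagFun} (hf : f.IsCDF) (hc : Continuous f) :
    Tendsto (fun k => gridGap k f f) atTop (𝓝 0) := by
  rw [Metric.tendsto_nhds]
  intro e he
  have he4 : 0 < e / 4 := by linarith
  obtain ⟨l, hl⟩ := (hf.2.1.eventually (gt_mem_nhds he4)).exists
  obtain ⟨r, hr⟩ := (hf.2.2.eventually (lt_mem_nhds (show 1 - e / 4 < 1 by linarith))).exists
  obtain ⟨δ, hδ, hmod⟩ := hf.exists_modulus hc he4
  have hk0 : Tendsto (fun k : ℕ => (k : ℝ) + 1) atTop atTop :=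
    tendsto_atTop_add_const_right _ _ tendsto_natCast_atTop_atTop
  filter_upwards [hk0.eventually_ge_atTop (3 / δ), hk0.eventually_ge_atTop (-l),
    hk0.eventually_ge_atTop r] with k k1 k2 k3
  have hκ : (0 : ℝ) < (k : ℝ) + 1 := by positivity
  set N : ℤ := ((k : ℤ) + 1) ^ 2 with hN
  have hNκ : (N : ℝ) / ((k : ℝ) + 1) = (k : ℝ) + 1 := by
    rw [hN]; push_cast; field_simp
  have hδκ : 3 / ((k : ℝ) + 1) ≤ δ := by
    rw [div_le_iff₀ hδ] at k1
    rw [div_le_iff₀ hκ]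
    linarith
  have h0 : 0 ≤ gridGap k f f := (abs_nonneg _).trans (abs_sub_le_gridGap hf hf k 0)
  rw [Real.dist_eq, sub_zero, abs_of_nonneg h0]
  refine lt_of_le_of_lt (b := 3 * (e / 4)) ?_ (by linarith)
  unfold gridGap
  refine Finset.sup'_le _ _ fun i hi => ?_
  rw [max_self]
  have hA : gridAvg k (i + 1) f ≤ f ((i + 2) / ((k : ℝ) + 1)) + e / 4 := by
    rcases le_or_gt (i + 1) N with h | h
    · have := hf.gridAvg_le (k := k) (i := i + 1) (by rwa [← hN])
        (u := (i + 2) / ((k : ℝ) + 1)) (Or.inl (by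
          push_cast; rw [add_assoc]; norm_num))
      linarith
    · have h1 : (N : ℝ) ≤ i + 2 := by
        have : N ≤ i + 2 := by omega
        exact_mod_cast this
      have h2 : r ≤ (i + 2) / ((k : ℝ) + 1) := by
        rw [← hNκ] at k3
        exact k3.trans (by gcongr)
      have h3 := hf.1 h2
      have h4 : gridAvg k (i + 1) f ≤ 1 := by
        unfold gridAvg
        rw [if_neg (by rw [← hN]; nlinarith [sq_nonneg ((k : ℤ) + 1)]), if_pos (by rwa [← hN])]
      linarith
  have hB : f ((i - 1) / ((k : ℝ) + 1)) - e / 4 ≤ gridAvg k (i - 1) f := by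
    rcases le_or_gt (-N) (i - 1) with h | h
    · have := hf.le_gridAvg (k := k) (i := i - 1) (by rwa [← hN])
        (u := (i - 1) / ((k : ℝ) + 1)) (Or.inl (by push_cast; exact le_rfl))
      linarith
    · have h1 : (i : ℝ) - 1 ≤ -N := by exact_mod_cast h.le
      have h2 : (i - 1) / ((k : ℝ) + 1) ≤ l := by
        rw [← hNκ] at k2
        refine le_trans (div_le_div_of_nonneg_right h1 hκ.le) ?_
        rw [neg_div]
        linarith
      have h3 := hf.1 h2
      have h4 : gridAvg k (i - 1) f = 0 := by
        unfold gridAvg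
        rw [if_pos (by rwa [← hN])]
      linarith
  have hC := hmod ((i - 1) / ((k : ℝ) + 1)) ((i + 2) / ((k : ℝ) + 1)) (by gcongr; linarith) (by
    have : ((i : ℝ) + 2) / ((k : ℝ) + 1) = (i - 1) / ((k : ℝ) + 1) + 3 / ((k : ℝ) + 1) := by
      field_simp; ring
    rw [this]
    gcongr)
  linarith

attribute [irreducible] gridGap

end CadlagFun

open CadlagFun

/-! ### Uniform closeness, and validity from a dense set of levels. -/

section Bootstrap

variable {Ω : ℕ → Type*} [∀ n, MeasurableSpace (Ω n)]
  {P : (n : ℕ) → Measure (Ω n)} [∀ n, IsProbabilityMeasure (P n)]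
  {SD SX : ℕ → Type*} [∀ n, MeasurableSpace (SD n)] [∀ n, MeasurableSpace (SX n)]
  {D : (n : ℕ) → Ω n → SD n} {τ τstar : (n : ℕ) → Ω n → ℝ}
  {X : (n : ℕ) → Ω n → SX n} {Ω' : Type*} [MeasurableSpace Ω'] {P' : Measure Ω'}
  [IsProbabilityMeasure P'] {F Fstar : Ω' → CadlagFun}

/-- Random cdfs which converge jointly to indistinguishable limits with continuous paths are
uniformly close in probability. -/
theorem tendstoInProbConst_iSup_abs_sub {S' : Type*} [TopologicalSpace S'] {X' : Ω' → S'}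
    {Xn' : (n : ℕ) → Ω n → S'} {G Gstar : (n : ℕ) → Ω n → CadlagFun}
    (hG : ∀ n ω, (G n ω).IsCDF) (hGstar : ∀ n ω, (Gstar n ω).IsCDF) (hF : Measurable F)
    (hFcdf : ∀ᵐ ω ∂P', (F ω).IsCDF ∧ Continuous (F ω))
    (hconv : TendstoWeakly (fun n ω => (G n ω, Gstar n ω, Xn' n ω))
      (fun ω => (F ω, Fstar ω, X' ω)) P P') (heq : ∀ᵐ ω ∂P', F ω = Fstar ω) :
    TendstoInProbConst P (fun n ω => ⨆ u : ℝ, |G n ω u - Gstar n ω u|) 0 := by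
  intro e he
  rw [ENNReal.tendsto_nhds_zero]
  intro d hd
  have hmeas : ∀ k, Measurable fun ω => gridGap k (F ω) (F ω) := fun k =>
    ((continuous_gridGap k).comp (continuous_id.prodMk continuous_id)).measurable.comp hF
  have htm : TendstoInMeasure P' (fun k ω => gridGap k (F ω) (F ω)) atTop fun _ => 0 := by
    refine tendstoInMeasure_of_tendsto_ae (fun k => (hmeas k).aestronglyMeasurable) ?_
    filter_upwards [hFcdf] with ω h
    exact h.1.tendsto_gridGap h.2
  obtain ⟨k, hk⟩ := ((tendstoInMeasure_iff_norm.1 htm e he).eventually (gt_mem_nhds hd)).exists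
  have hc : Continuous fun z : CadlagFun × CadlagFun × S' => gridGap k z.1 z.2.1 :=
    (continuous_gridGap k).comp (continuous_fst.prodMk (continuous_fst.comp continuous_snd))
  have hw : TendstoInDistribution (fun n ω => gridGap k (G n ω) (Gstar n ω)) atTop
      (fun ω => gridGap k (F ω) (Fstar ω)) P P' := hconv.continuous_comp hc
  have hlt : P' {ω | gridGap k (F ω) (Fstar ω) ∈ Ici e} < d := by
    refine lt_of_le_of_lt (measure_mono_ae ?_) hk
    filter_upwards [heq] with ω h1 h2
    have h3 : e ≤ gridGap k (F ω) (Fstar ω) := h2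
    rw [← h1] at h3
    have : e ≤ ‖gridGap k (F ω) (F ω) - 0‖ := by
      rw [sub_zero]; exact h3.trans (le_abs_self _)
    exact this
  filter_upwards [hw.eventually_measure_closed_lt isClosed_Ici hlt] with n hn
  refine le_trans (measure_mono (t := {ω | gridGap k (G n ω) (Gstar n ω) ∈ Ici e})
    fun ω hω => ?_) hn.le
  rw [mem_ofPred_eq]
  have h1 : e ≤ |(⨆ u : ℝ, |G n ω u - Gstar n ω u|) - 0| := hω
  rw [sub_zero, abs_of_nonneg (Real.iSup_nonneg fun _ => abs_nonneg _)] at h1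
  exact mem_Ici.2 (h1.trans <| ciSup_le fun u => abs_sub_le_gridGap (hG n ω) (hGstar n ω) k u)

/-- Validity at all levels follows from validity at a dense set of levels. -/
lemma bootstrapValidCond_of_dense (hD : ∀ n, Measurable (D n)) {s : Set ℝ} (hs : Dense s)
    (h : ∀ q ∈ s, q ∈ Ioo (0 : ℝ) 1 → TendstoInProbConst P
      (fun n => condPValueCdf (P n) (D n) (τ n) (τstar n) (X n) q) q) :
    BootstrapValidCond P D τ τstar X := by
  intro q hq e he
  -- Conditional p-value probabilities increase in the level, so control at `a < q < b` within `e /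
  -- 2` of `q` gives control at `q`.
  obtain ⟨a, ha, a1, a2⟩ := hs.exists_between (show max 0 (q - e / 2) < q from
    max_lt hq.1 (by linarith))
  obtain ⟨b, hb, b1, b2⟩ := hs.exists_between (show q < min 1 (q + e / 2) from
    lt_min hq.2 (by linarith))
  rw [max_lt_iff] at a1
  rw [lt_min_iff] at b2
  have hA := h a ha ⟨a1.1, a2.trans hq.2⟩ (e / 2) (by linarith)
  have hB := h b hb ⟨hq.1.trans b1, b2.1⟩ (e / 2) (by linarith)
  have hAB := hA.add hB
  rw [add_zero] at hAB
  refine tendsto_of_tendsto_of_tendsto_of_le_of_le tendsto_const_nhds hAB (fun _ => bot_le)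
    fun n => le_trans (measure_mono_ae ?_) (measure_union_le _ _)
  have hp : ∀ q : ℝ, NullMeasurableSet
      {ω | bootPValue (P n) (D n) (τ n) (τstar n) ω ≤ q} (P n) := fun q =>
    (measurableSet_le (measurable_condProbGiven (hD n) _) measurable_const).nullMeasurableSet
  filter_upwards [condProbGiven_mono (X := X n) (hp a) (hp q) fun ω hω => le_trans hω a2.le,
    condProbGiven_mono (X := X n) (hp q) (hp b) fun ω hω => le_trans hω b1.le] with ω h1 h2 h3
  by_contra hcon
  have h3' : e ≤ |condPValueCdf (P n) (D n) (τ n) (τstar n) (X n) q ω - q| := h3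
  obtain ⟨c1, c2⟩ := not_or.1 hcon
  have c1' : |condPValueCdf (P n) (D n) (τ n) (τstar n) (X n) a ω - a| < e / 2 := not_le.1 c1
  have c2' : |condPValueCdf (P n) (D n) (τ n) (τstar n) (X n) b ω - b| < e / 2 := not_le.1 c2
  have h1' : condPValueCdf (P n) (D n) (τ n) (τstar n) (X n) a ω ≤
    condPValueCdf (P n) (D n) (τ n) (τstar n) (X n) q ω := h1
  have h2' : condPValueCdf (P n) (D n) (τ n) (τstar n) (X n) q ω ≤
    condPValueCdf (P n) (D n) (τ n) (τstar n) (X n) b ω := h2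
  rw [abs_lt] at c1' c2'
  exact h3'.not_gt (abs_lt.2 ⟨by linarith [c1'.1], by linarith [c2'.2]⟩)

end Bootstrap

end

/-! ### Assembly of the three statements. -/

theorem theoremp2
    -- for each `n`, a probability space carrying the data `D n` and auxiliary variates `W n`
    {Ω : ℕ → Type*} [∀ n, MeasurableSpace (Ω n)]
    (P : (n : ℕ) → Measure (Ω n)) [∀ n, IsProbabilityMeasure (P n)]
    {SD SW SX : ℕ → Type*}
    [∀ n, MeasurableSpace (SD n)] [∀ n, StandardBorelSpace (SD n)]
    [∀ n, MeasurableSpace (SW n)] [∀ n, StandardBorelSpace (SW n)]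
    [∀ n, MeasurableSpace (SX n)] [∀ n, StandardBorelSpace (SX n)]
    (D : (n : ℕ) → Ω n → SD n) (hD : ∀ n, Measurable (D n))
    (W : (n : ℕ) → Ω n → SW n) (hW : ∀ n, Measurable (W n))
    -- the original statistic `τ n = t n (D n)` and the bootstrap statistic
    -- `τstar n = tstar n (D n, W n)`
    (t : (n : ℕ) → SD n → ℝ) (ht : ∀ n, Measurable (t n))
    (tstar : (n : ℕ) → SD n × SW n → ℝ) (htstar : ∀ n, Measurable (tstar n))
    (τ τstar : (n : ℕ) → Ω n → ℝ)
    (hτ : ∀ n, τ n = fun ω => t n (D n ω))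
    (hτstar : ∀ n, τstar n = fun ω => tstar n (D n ω, W n ω))
    -- `X n` is `D n`-measurable
    (X : (n : ℕ) → Ω n → SX n)
    (hX : ∀ n, Measurable[MeasurableSpace.comap (D n) inferInstance] (X n))
    -- the limiting random cdfs, a.s. sample-path continuous
    {Ω' : Type*} [MeasurableSpace Ω'] (P' : Measure Ω') [IsProbabilityMeasure P']
    (F Fstar : Ω' → CadlagFun) (hF : Measurable F) (hFstar : Measurable Fstar)
    (hFcdf : ∀ᵐ ω ∂P', (F ω).IsCDF ∧ Continuous (F ω))
    (hFstarcdf : ∀ᵐ ω ∂P', (Fstar ω).IsCDF ∧ Continuous (Fstar ω))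
    -- `X'` with `Fstar` (a.s.) `X'`-measurable, and `X' n` which are `X n`-measurable
    {S' : Type*} [TopologicalSpace S'] [PolishSpace S'] [MeasurableSpace S'] [BorelSpace S']
    (X' : Ω' → S') (hX' : Measurable X')
    (hFstarX' : ∃ φ : S' → CadlagFun, Measurable φ ∧ ∀ᵐ ω ∂P', Fstar ω = φ (X' ω))
    (Xn' : (n : ℕ) → Ω n → S')
    (hXn' : ∀ n, Measurable[MeasurableSpace.comap (X n) inferInstance] (Xn' n))
    -- `(P(τ_n ≤ · | X_n), P(τ*_n ≤ · | D_n), X'_n) →w (F, F*, X')`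
    (hconv : TendstoWeakly
      (fun n ω => (condCdf (P n) (τ n) (X n) ω, condCdf (P n) (τstar n) (D n) ω, Xn' n ω))
      (fun ω => (F ω, Fstar ω, X' ω)) P P') :
    (∀ᵐ q ∂(volume.restrict (Ioo (0 : ℝ) 1)),
      TendstoWeakly (fun n => condPValueCdf (P n) (D n) (τ n) (τstar n) (X n) q)
        (fun ω => F ω (genInv (Fstar ω) q)) P P') ∧
    (BootstrapValidCond P D τ τstar X ↔ ∀ᵐ ω ∂P', F ω = Fstar ω) ∧
    ((∀ᵐ ω ∂P', F ω = Fstar ω) →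
      TendstoInProbConst P
        (fun n ω => ⨆ u : ℝ,
          |condCdf (P n) (τ n) (X n) ω u - condCdf (P n) (τstar n) (D n) ω u|) 0) := by
  obtain rfl : τ = fun n ω => t n (D n ω) := funext hτ
  have hτstarm : ∀ n, Measurable (τstar n) := fun n => by
    rw [hτstar n]
    exact (htstar n).comp ((hD n).prodMk (hW n))
  have hXm : ∀ n, Measurable (X n) := fun n => (hX n).mono (hD n).comap_le le_rfl
  have hFstarcdf' : ∀ᵐ ω ∂P', (Fstar ω).IsCDF := hFstarcdf.mono fun _ h => h.1
  obtain ⟨B, hB, hgood⟩ := countable_flat_level hFstar hFstarcdf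
  have hweak : ∀ q ∉ B, q ∈ Ioo (0 : ℝ) 1 → TendstoInDistribution
      (fun n => condPValueCdf (P n) (D n) (fun ω => t n (D n ω)) (τstar n) (X n) q) atTop
      (fun ω => F ω (genInv (Fstar ω) q)) P P' := fun q hqB hq =>
    tendstoInDistribution_condPValueCdf hD ht hτstarm hXm hF hFcdf hFstarcdf' hX' hFstarX' hXn'
      hconv hq (hgood q hqB)
  have hdense : Dense Bᶜ := hB.dense_compl ℝ
  refine ⟨?_, ⟨fun hvalid => ?_, fun heq => ?_⟩, fun heq => ?_⟩
  · have hBae : ∀ᵐ q ∂(volume : Measure ℝ), q ∉ B :=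
      measure_eq_zero_iff_ae_notMem.1 (hB.measure_zero volume)
    filter_upwards [ae_restrict_of_ae hBae, ae_restrict_mem measurableSet_Ioo] with q hqB hq
    exact hweak q hqB hq
  -- Countability allows a single null set to serve all levels in `s`.
  · obtain ⟨s, hsB, hs, hsd⟩ := hdense.exists_countable_dense_subset
    have hs' : ∀ᵐ ω ∂P', ∀ q ∈ s, q ∈ Ioo (0 : ℝ) 1 → F ω (genInv (Fstar ω) q) = q := by
      refine (ae_ball_iff hs).2 fun q hqs => ?_
      by_cases hq : q ∈ Ioo (0 : ℝ) 1
      · filter_upwards [(hvalid q hq).ae_eq_of_tendstoInDistribution (hweak q (hsB hqs) hq)]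
          with ω h _
        exact h
      · exact Eventually.of_forall fun ω h => absurd h hq
    filter_upwards [hs', hFcdf, hFstarcdf'] with ω h1 h2 h3
    exact CadlagFun.eq_of_apply_genInv h2.1 h3 hsd h1
  · refine bootstrapValidCond_of_dense hD hdense fun q hqB hq =>
      (hweak q hqB hq).tendstoInProbConst ?_
    filter_upwards [heq, hFstarcdf] with ω h1 h2
    rw [h1]
    exact h2.1.apply_genInv h2.2 hq
  · exact tendstoInProbConst_iSup_abs_sub (fun n ω => CadlagFun.isCDF_ofStieltjes_cdf _)
      (fun n ω => CadlagFun.isCDF_ofStieltjes_cdf _) hF hFcdf hconv heq
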